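/- **Setting.** An instance consists of $n$ tools, indexed by $[n]$ and partitioned into $\ell$ nonempty tool sets $T_1,\dots,T_\ell$, nonnegative first-stage costs $C\in\mathbb{R}^n_+$, nominal second-stage costs $\underline{c}\in\mathbb{R}^n_+$, maximal deviations $d\in\mathbb{R}^n_+$ and a budget $\Gamma\ge 0$. Let $$\mathcal{X}=\Big\{x\in\{0,1\}^n:\ \sum_{j\in T_l}x_j=1\ \text{ for all } l\in[\ell]\Big\},\qquad \mathcal{R}(x)=\{y\in\{0,1\}^n: x+y\in\mathcal{X}\},$$ $$\mathcal{X}'=\{x\in\{0,1\}^n:\mathcal{R}(x)\ne\emptyset\},\qquad \mathcal{U}=\Big\{\underline{c}+\delta:\ 0\le\delta\le d,\ \|\delta\|_1\le\Gamma\Big\}.$$ The robust two-stage Representatives Selection problem under continuous budgeted uncertainty is $$\min_{x\in\mathcal{X}'}\ \max_{c\in\mathcal{U}}\ \min_{y\in\mathcal{R}(x)}\ (C^Tx+c^Ty).$$ Put $\widehat{C}_l=\min_{j\in T_l}C_j$, and consider the mixed-integer program $$(\mathrm{M})\qquad \min\ \sum_{l}\widehat{C}_lx_l+\sum_j\underline{c}_ju_j+\Gamma\pi+\sum_j(\underline{c}_j+d_j)v_j$$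 subject to $x_l+\sum_{j\in T_l}(u_j+v_j)=1$ and $x_l\in\{0,1\}$ for $l\in[\ell]$, $u_j\in[0,\pi]$ and $v_j\in[0,1-\pi]$ for $j\in[n]$, and $\pi\in[0,1]$. **Theorem.** 1. There is a single real-RAM program (unit cost for each memory access, each comparison, each addition and subtraction of indices, each field operation on real numbers and each control step; no rounding) that, for every instance, computes an optimal first-stage solution $x\in\mathcal{X}'$ and the exact optimal value of the robust two-stage problem, in $O(n^2\log n)$ steps. 2. For every instance, the optimal value of $(\mathrm{M})$ equals that of the robust two-stage problem, and $(\mathrm{M})$ has an optimal solution $(x,u,v,\pi)$ such that $\pi=0$ or $\pi=1/p$ for some $p\in[n]$, and such that $(u,v,\pi)$ is a vertex of the polytope obtained from the constraints of $(\mathrm{M})$ by fixing $x$. 3. Let $\pi\in[0,1]$ be fixed. Call $(u,v)$ a greedy packing if in each tool set $T_l$ one unit in total is packed into the variables $u_j$ (unit cost $\underline{c}_j$, capacity $\pi$) and $v_j$ (unit cost $\underline{c}_j+d_j$, capacity $1-\pi$), $j\in T_l$, and no variable is positive while a strictly cheaper variable of the same tool set is below its capacity. A greedy packing exists. For every greedy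 packing, an optimal solution of $(\mathrm{M})$ with this fixed $\pi$ is obtained as follows: for each $l$, if $\widehat{C}_l$ is at most the cost of the packing in $T_l$, set $x_l=1$ and $u_j=v_j=0$ for $j\in T_l$; otherwise set $x_l=0$ and keep the packing in $T_l$. -/

import Mathlib

namespace RTSt

/-! ### Robust two-stage problems -/

/-- The 0-1 vectors. -/
def Binary {ι : Type} (x : ι → ℝ) : Prop := ∀ i, x i = 0 ∨ x i = 1

/-- Recourse actions `R(x)` of a combinatorial problem with feasible set `X`. -/
def recourse {n : ℕ} (X : Set (Fin n → ℝ)) (x : Fin n → ℝ) : Set (Fin n → ℝ) :=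
  {y | Binary y ∧ x + y ∈ X}

/-- Partial solutions `X'`: the 0-1 vectors that can be completed to a feasible solution. -/
def partialSolutions {n : ℕ} (X : Set (Fin n → ℝ)) : Set (Fin n → ℝ) :=
  {x | Binary x ∧ (recourse X x).Nonempty}

/-- `v = min_{y ∈ R(x)} (Cᵀx + cᵀy)`. -/
def IsRecourseValue {n : ℕ} (X : Set (Fin n → ℝ)) (C x c : Fin n → ℝ) (v : ℝ) : Prop :=
  IsLeast ((fun y => ∑ j, C j * x j + ∑ j, c j * y j) '' recourse X x) v

/-- `v = max_{c ∈ U} min_{y ∈ R(x)} (Cᵀx + cᵀy)`. -/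
def IsEval {n : ℕ} (X U : Set (Fin n → ℝ)) (C x : Fin n → ℝ) (v : ℝ) : Prop :=
  IsGreatest {w | ∃ c ∈ U, IsRecourseValue X C x c w} v

/-- `v = min_{x ∈ X'} max_{c ∈ U} min_{y ∈ R(x)} (Cᵀx + cᵀy)`. -/
def IsOptimalValue {n : ℕ} (X U : Set (Fin n → ℝ)) (C : Fin n → ℝ) (v : ℝ) : Prop :=
  IsLeast {w | ∃ x ∈ partialSolutions X, IsEval X U C x w} v

/-! ### Representatives selection under continuous budgeted uncertainty -/

/-- An instance with `n` tools that are partitioned into `ℓ` nonempty tool sets: tool `j` belongs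
to the tool set number `label j`. -/
structure RSInstance (n ℓ : ℕ) where
  label : Fin n → Fin ℓ
  label_surjective : Function.Surjective label
  /-- first-stage costs -/
  C : Fin n → ℝ
  /-- nominal second-stage costs -/
  c : Fin n → ℝ
  /-- largest deviations of the second-stage costs -/
  d : Fin n → ℝ
  /-- the budget -/
  Γ : ℝ
  C_nonneg : ∀ j, 0 ≤ C j
  c_nonneg : ∀ j, 0 ≤ c j
  d_nonneg : ∀ j, 0 ≤ d j
  Γ_nonneg : 0 ≤ Γ

namespace RSInstance

variable {n ℓ : ℕ} (I : RSInstance n ℓ)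

/-- The tool set `T_l`. -/
def T (l : Fin ℓ) : Finset (Fin n) := Finset.univ.filter fun j => I.label j = l

theorem T_nonempty (l : Fin ℓ) : (I.T l).Nonempty := by
  obtain ⟨j, hj⟩ := I.label_surjective l
  exact ⟨j, by simp [T, hj]⟩

/-- Feasible selections: exactly one tool from each tool set. -/
def X : Set (Fin n → ℝ) := {x | Binary x ∧ ∀ l, ∑ j ∈ I.T l, x j = 1}

/-- Continuous budgeted uncertainty. -/
def U : Set (Fin n → ℝ) :=
  {s | ∃ δ : Fin n → ℝ, (∀ j, 0 ≤ δ j ∧ δ j ≤ I.d j) ∧ ∑ j, |δ j| ≤ I.Γ ∧ s = I.c + δ}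

/-- The cheapest first-stage cost in a tool set. -/
noncomputable def Chat (l : Fin ℓ) : ℝ := (I.T l).inf' (I.T_nonempty l) I.C

/-! ### The mixed-integer program -/

/-- The polytope of the pairs `(u, v)` and `π` that are feasible together with a fixed `x`. -/
def polytope (x : Fin ℓ → ℝ) : Set ((Fin n → ℝ) × (Fin n → ℝ) × ℝ) :=
  {q | (∀ l, x l + ∑ j ∈ I.T l, (q.1 j + q.2.1 j) = 1) ∧
    (∀ j, 0 ≤ q.1 j ∧ q.1 j ≤ q.2.2) ∧
    (∀ j, 0 ≤ q.2.1 j ∧ q.2.1 j ≤ 1 - q.2.2) ∧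
    0 ≤ q.2.2 ∧ q.2.2 ≤ 1}

/-- Feasibility in the mixed-integer program. -/
def MIPFeasible (x : Fin ℓ → ℝ) (u v : Fin n → ℝ) (π : ℝ) : Prop :=
  Binary x ∧ (u, v, π) ∈ I.polytope x

/-- The objective function of the mixed-integer program. -/
noncomputable def obj (x : Fin ℓ → ℝ) (u v : Fin n → ℝ) (π : ℝ) : ℝ :=
  ∑ l, I.Chat l * x l + ∑ j, I.c j * u j + I.Γ * π + ∑ j, (I.c j + I.d j) * v j

/-- For a fixed `π`, `(u, v)` packs one unit in every tool set greedily: the capacities are `π` for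
each `u j` and `1 - π` for each `v j`, the unit costs are `c j` and `c j + d j`, and nothing is
packed into a variable before all cheaper variables of the same tool set are full. The two
summands of `Fin n ⊕ Fin n` index the variables `u j` and the variables `v j`. -/
def IsGreedyPacking (π : ℝ) (u v : Fin n → ℝ) : Prop :=
  (∀ l, ∑ j ∈ I.T l, (u j + v j) = 1) ∧
  (∀ j, 0 ≤ u j ∧ u j ≤ π) ∧
  (∀ j, 0 ≤ v j ∧ v j ≤ 1 - π) ∧
  ∀ a b : Fin n ⊕ Fin n,
    Sum.elim I.label I.label a = Sum.elim I.label I.label b →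
    Sum.elim I.c (I.c + I.d) a < Sum.elim I.c (I.c + I.d) b →
    0 < Sum.elim u v b →
    Sum.elim u v a = Sum.elim (fun _ => π) (fun _ => 1 - π) a

/-- The cost of a packing inside the tool set `T_l`. -/
def packCost (u v : Fin n → ℝ) (l : Fin ℓ) : ℝ :=
  ∑ j ∈ I.T l, (I.c j * u j + (I.c j + I.d j) * v j)

open Classical in
/-- Choose the first stage in exactly those tool sets where it is at most as expensive as the
packing. -/
noncomputable def firstStage (u v : Fin n → ℝ) (l : Fin ℓ) : ℝ :=
  if I.Chat l ≤ I.packCost u v l then 1 else 0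

/-- Keep the part `w` of the packing `(u, v)` only in the tool sets left to the second stage. -/
noncomputable def keep (u v w : Fin n → ℝ) (j : Fin n) : ℝ :=
  (1 - I.firstStage u v (I.label j)) * w j

end RSInstance

/-! ### Real random access machine

The memory consists of arrays of natural numbers, used for indices and counters, and arrays of
real numbers. A program is a finite text that names finitely many arrays; an array cell is
addressed by a computed index. Every arithmetic operation, comparison, memory access and control
step costs one unit. Natural numbers can only be added, subtracted (truncated at zero) and
compared; on real numbers there are the four field operations (with `x / 0 = 0`) and comparison.
There is no rounding, and the only constants are natural numbers. -/

/-- `nat a i` and `real a i` are the cells number `i` of the arrays number `a`. -/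
structure Store where
  nat : ℕ → ℕ → ℕ
  real : ℕ → ℕ → ℝ

namespace Store

def setNat (s : Store) (a i v : ℕ) : Store :=
  { s with nat := Function.update s.nat a (Function.update (s.nat a) i v) }

noncomputable def setReal (s : Store) (a i : ℕ) (v : ℝ) : Store :=
  { s with real := Function.update s.real a (Function.update (s.real a) i v) }

end Store

inductive NExp where
  | const (k : ℕ)
  | get (a : ℕ) (i : NExp)
  | add (e f : NExp)
  | sub (e f : NExp)

namespace NExp

def eval (s : Store) : NExp → ℕ
  | const k => k
  | get a i => s.nat a (i.eval s)
  | add e f => e.eval s + f.eval s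
  | sub e f => e.eval s - f.eval s

def cost : NExp → ℕ
  | const _ => 1
  | get _ i => i.cost + 1
  | add e f => e.cost + f.cost + 1
  | sub e f => e.cost + f.cost + 1

end NExp

inductive RExp where
  | const (k : ℕ)
  | get (a : ℕ) (i : NExp)
  | add (e f : RExp)
  | sub (e f : RExp)
  | mul (e f : RExp)
  | div (e f : RExp)

namespace RExp

noncomputable def eval (s : Store) : RExp → ℝ
  | const k => k
  | get a i => s.real a (i.eval s)
  | add e f => e.eval s + f.eval s
  | sub e f => e.eval s - f.eval s
  | mul e f => e.eval s * f.eval s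
  | div e f => e.eval s / f.eval s

def cost : RExp → ℕ
  | const _ => 1
  | get _ i => i.cost + 1
  | add e f => e.cost + f.cost + 1
  | sub e f => e.cost + f.cost + 1
  | mul e f => e.cost + f.cost + 1
  | div e f => e.cost + f.cost + 1

end RExp

/-- Tests. -/
inductive BExp where
  | natLe (e f : NExp)
  | realLe (e f : RExp)
  | not (b : BExp)
  | and (b b' : BExp)

namespace BExp

def Holds (s : Store) : BExp → Prop
  | natLe e f => e.eval s ≤ f.eval s
  | realLe e f => e.eval s ≤ f.eval s
  | not b => ¬ b.Holds s
  | and b b' => b.Holds s ∧ b'.Holds s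

def cost : BExp → ℕ
  | natLe e f => e.cost + f.cost + 1
  | realLe e f => e.cost + f.cost + 1
  | not b => b.cost + 1
  | and b b' => b.cost + b'.cost + 1

end BExp

inductive Program where
  | skip
  | setNat (a : ℕ) (i : NExp) (e : NExp)
  | setReal (a : ℕ) (i : NExp) (e : RExp)
  | seq (P Q : Program)
  | ite (b : BExp) (P Q : Program)
  | loop (b : BExp) (P : Program)

/-- `Exec P s s' t`: the program `P`, started in the memory `s`, stops in the memory `s'` after
exactly `t` steps. `Program.loop b P` is the loop "while `b` do `P`". -/
inductive Exec : Program → Store → Store → ℕ → Prop where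
  | skip (s : Store) : Exec Program.skip s s 1
  | setNat (a : ℕ) (i e : NExp) (s : Store) :
      Exec (Program.setNat a i e) s (s.setNat a (i.eval s) (e.eval s)) (i.cost + e.cost + 1)
  | setReal (a : ℕ) (i : NExp) (e : RExp) (s : Store) :
      Exec (Program.setReal a i e) s (s.setReal a (i.eval s) (e.eval s)) (i.cost + e.cost + 1)
  | seq {P Q : Program} {s s' s'' : Store} {t t' : ℕ} :
      Exec P s s' t → Exec Q s' s'' t' → Exec (Program.seq P Q) s s'' (t + t')
  | ite_true {b : BExp} {P Q : Program} {s s' : Store} {t : ℕ} :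
      b.Holds s → Exec P s s' t → Exec (Program.ite b P Q) s s' (b.cost + 1 + t)
  | ite_false {b : BExp} {P Q : Program} {s s' : Store} {t : ℕ} :
      ¬ b.Holds s → Exec Q s s' t → Exec (Program.ite b P Q) s s' (b.cost + 1 + t)
  | loop_false {b : BExp} {P : Program} {s : Store} :
      ¬ b.Holds s → Exec (Program.loop b P) s s (b.cost + 1)
  | loop_true {b : BExp} {P : Program} {s s' s'' : Store} {t t' : ℕ} :
      b.Holds s → Exec P s s' t → Exec (Program.loop b P) s' s'' t' →
      Exec (Program.loop b P) s s'' (b.cost + 1 + t + t')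

/-! ### Input and output -/

/-- A vector written into the first cells of an array, followed by zeros. -/
def toArray {α : Type} [Zero α] {n : ℕ} (f : Fin n → α) (i : ℕ) : α :=
  if h : i < n then f ⟨i, h⟩ else 0

/-- The input: the first natural-number array holds `n, ℓ`, the next one the number of the tool set
of each tool; the first four real arrays hold `Γ`, `C`, `c` and `d`. All other cells are zero. -/
noncomputable def RSInstance.encode {n ℓ : ℕ} (I : RSInstance n ℓ) : Store where
  nat := fun a => match a with
    | 0 => toArray ![n, ℓ]
    | 1 => toArray fun j => (I.label j : ℕ)
    | _ => fun _ => 0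
  real := fun a => match a with
    | 0 => toArray ![I.Γ]
    | 1 => toArray I.C
    | 2 => toArray I.c
    | 3 => toArray I.d
    | _ => fun _ => 0

/-- The output in the memory `s` solves the instance: real array 4 holds an optimal first-stage
solution `x` in its first `n` cells, and cell 0 of real array 5 the optimal value. -/
def RSInstance.SolvedBy {n ℓ : ℕ} (I : RSInstance n ℓ) (s : Store) : Prop :=
  (fun j : Fin n => s.real 4 j) ∈ partialSolutions I.X ∧
  IsEval I.X I.U I.C (fun j : Fin n => s.real 4 j) (s.real 5 0) ∧
  IsOptimalValue I.X I.U I.C (s.real 5 0)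

end RTSt

/-! Fix a first stage and call a tool set open if it is left to the second stage. The recourse
splits over the tool sets, so the adversary maximizes the sum of the smallest costs in the open
sets. Equivalently, the adversary picks a level `t l` at most `worst l` in each open set and pays
`lift l (t l)`, the deviation needed to raise every tool of the set to that level, subject to the
budget Γ. The dual of this linear program is the second-stage part of (M): `u + v` are weights on
the tools, and `π` is the price of budget.

The function `lift l` is convex and piecewise linear, and its slopes are the integers `q` counting
the tools below the level. Between `level q l` and `level (q + 1) l` the slope is `q` in all sets
simultaneously. Water filling therefore finds one `q` at which the budget runs out, and levels at
the same fraction of these segments use exactly Γ. On such levels `lift_eq_of_isLevel` turns the sum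
of the levels into `stageCost z q`, the cost of an explicit packing with `π = 1 / q`. If the budget
never runs out, then `π = 0`. This is strong duality (`exists_scenario`); with weak duality
(`sum_level_le_secondCost`) it shows that the worst case of a first stage is the minimum of
`stageCost z q` over `q ≤ n`.

The minima over first stages and over `q` can be exchanged. For fixed `q` the tool sets decouple,
each contributing the smaller of `Chat l` and `unitCost q l`; this gives `leastCost q`. Minimizing
`leastCost` over `0, …, n` solves both the robust problem and (M). With ranks and worst-case costs
tabulated in quadratic time by pairwise comparison, each `leastCost q` takes linear time, so the
program is in fact quadratic.

For the vertex claim, an optimal packing with `π = 1 / q` is determined by its tight constraints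
once some open set is filled by exactly `q` variables `u j = π`. If no such set exists, the cost
depends on `π` affinely with a nonnegative slope, and `π = 0` is also optimal. The greedy claim is
an exchange argument for a fractional knapsack in each tool set. -/

namespace RTSt

/-! ### Ranking the tools of a tool set -/

/-- `i` comes before `j` when indices are ordered by their weight, ties broken by the index. -/
def Precedes {ι : Type} [LinearOrder ι] (w : ι → ℝ) (i j : ι) : Prop :=
  w i ≤ w j ∧ ¬ (w j ≤ w i ∧ j ≤ i)

section Precedes

variable {ι : Type} [LinearOrder ι] {w : ι → ℝ} {i j k : ι}

theorem Precedes.irrefl : ¬ Precedes w i i := fun h => h.2 ⟨le_rfl, le_rfl⟩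

theorem Precedes.trans (h : Precedes w i j) (h' : Precedes w j k) : Precedes w i k := by
  refine ⟨h.1.trans h'.1, fun h'' => ?_⟩
  have hji : w j ≤ w i := h'.1.trans h''.1
  have hkj : w k ≤ w j := h''.1.trans h.1
  have hij : i < j := not_le.1 fun hh => h.2 ⟨hji, hh⟩
  have hjk : j < k := not_le.1 fun hh => h'.2 ⟨hkj, hh⟩
  exact absurd (hij.trans hjk) (not_lt.2 h''.2)

theorem Precedes.total (h : i ≠ j) : Precedes w i j ∨ Precedes w j i := by
  unfold Precedes
  rcases lt_trichotomy (w i) (w j) with h1 | h1 | h1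
  · exact Or.inl ⟨h1.le, fun h2 => absurd h1 (not_lt.2 h2.1)⟩
  · rcases lt_or_gt_of_ne h with h2 | h2
    · exact Or.inl ⟨h1.le, fun h3 => absurd h2 (not_lt.2 h3.2)⟩
    · exact Or.inr ⟨h1.ge, fun h3 => absurd h2 (not_lt.2 h3.2)⟩
  · exact Or.inr ⟨h1.le, fun h2 => absurd h1 (not_lt.2 h2.1)⟩

end Precedes

namespace RSInstance

variable {n ℓ : ℕ} (I : RSInstance n ℓ)

theorem mem_T {j : Fin n} {l : Fin ℓ} : j ∈ I.T l ↔ I.label j = l := by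
  simp [T]

open Classical in
/-- The number of tools in the tool set of `j` that precede `j` with respect to `w`. -/
noncomputable def rank (w : Fin n → ℝ) (j : Fin n) : ℕ :=
  ((I.T (I.label j)).filter fun i => Precedes w i j).card

variable {I} {w : Fin n → ℝ} {i j : Fin n} {l : Fin ℓ}

/-- By transitivity the predecessors of `i` are predecessors of `j`, and `i` itself is an additional
one. -/
theorem rank_lt_rank (hl : I.label i = I.label j) (h : Precedes w i j) :
    I.rank w i < I.rank w j := by
  classical
  refine Finset.card_lt_card ⟨fun k hk => ?_, fun hk => ?_⟩
  · simp only [Finset.mem_filter, mem_T] at hk ⊢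
    exact ⟨hk.1.trans hl, hk.2.trans h⟩
  · have := @hk i (by simp [mem_T, hl, h])
    simp only [Finset.mem_filter] at this
    exact Precedes.irrefl this.2

theorem weight_le_of_rank_le (hl : I.label i = I.label j) (h : I.rank w i ≤ I.rank w j) :
    w i ≤ w j := by
  rcases eq_or_ne i j with rfl | hne
  · exact le_rfl
  · rcases Precedes.total (w := w) hne with h1 | h1
    · exact h1.1
    · exact absurd (rank_lt_rank hl.symm h1) (not_lt.2 h)

theorem rank_injOn (w : Fin n → ℝ) (l : Fin ℓ) : Set.InjOn (I.rank w) (I.T l) := by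
  intro i hi j hj h
  have hl : I.label i = I.label j := (I.mem_T.1 hi).trans (I.mem_T.1 hj).symm
  by_contra hne
  rcases Precedes.total (w := w) hne with h1 | h1
  · exact absurd h (rank_lt_rank hl h1).ne
  · exact absurd h (rank_lt_rank hl.symm h1).ne'

theorem rank_lt_card (hj : j ∈ I.T l) : I.rank w j < (I.T l).card := by
  classical
  obtain rfl := I.mem_T.1 hj
  refine Finset.card_lt_card ⟨Finset.filter_subset _ _, fun h => ?_⟩
  exact Precedes.irrefl (Finset.mem_filter.1 (h hj)).2

theorem rank_lt (w : Fin n → ℝ) (j : Fin n) : I.rank w j < n :=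
  (rank_lt_card (I.mem_T.2 rfl)).trans_le
    ((Finset.card_le_univ _).trans_eq (Fintype.card_fin n))

theorem image_rank (w : Fin n → ℝ) (l : Fin ℓ) :
    (I.T l).image (I.rank w) = Finset.range (I.T l).card := by
  refine Finset.eq_of_subset_of_card_le (fun k hk => ?_) ?_
  · obtain ⟨j, hj, rfl⟩ := Finset.mem_image.1 hk
    exact Finset.mem_range.2 (rank_lt_card hj)
  · rw [Finset.card_range, Finset.card_image_of_injOn (rank_injOn w l)]

theorem card_rank_lt_le (w : Fin n → ℝ) (l : Fin ℓ) (q : ℕ) :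
    ((I.T l).filter fun j => I.rank w j < q).card ≤ q := by
  have hinj : Set.InjOn (I.rank w) ((I.T l).filter fun j => I.rank w j < q) :=
    (rank_injOn w l).mono (Finset.coe_subset.2 (Finset.filter_subset _ _))
  rw [← Finset.card_image_of_injOn hinj]
  refine (Finset.card_le_card (t := Finset.range q) fun k hk => ?_).trans_eq (Finset.card_range q)
  obtain ⟨j, hj, rfl⟩ := Finset.mem_image.1 hk
  exact Finset.mem_range.2 (Finset.mem_filter.1 hj).2

theorem card_rank_lt (w : Fin n → ℝ) {q : ℕ} (hq : q ≤ (I.T l).card) :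
    ((I.T l).filter fun j => I.rank w j < q).card = q := by
  refine le_antisymm (card_rank_lt_le w l q) ?_
  have hsub : Finset.range q ⊆ ((I.T l).filter fun j => I.rank w j < q).image (I.rank w) := by
    intro k hk
    have hk' := Finset.mem_range.1 hk
    have : k ∈ (I.T l).image (I.rank w) := by
      rw [image_rank]; exact Finset.mem_range.2 (hk'.trans_le hq)
    obtain ⟨j, hj, rfl⟩ := Finset.mem_image.1 this
    exact Finset.mem_image.2 ⟨j, Finset.mem_filter.2 ⟨hj, hk'⟩, rfl⟩
  calc q = (Finset.range q).card := (Finset.card_range q).symm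
    _ ≤ _ := Finset.card_le_card hsub
    _ ≤ _ := Finset.card_image_le

theorem exists_rank_eq_zero (w : Fin n → ℝ) (l : Fin ℓ) : ∃ j ∈ I.T l, I.rank w j = 0 := by
  have : 0 ∈ (I.T l).image (I.rank w) := by
    rw [image_rank]; exact Finset.mem_range.2 (Finset.card_pos.2 (I.T_nonempty l))
  exact Finset.mem_image.1 this

theorem weight_le_of_rank_eq_zero (hl : I.label i = I.label j) (h : I.rank w i = 0) :
    w i ≤ w j :=
  weight_le_of_rank_le hl (h.trans_le (Nat.zero_le _))

variable (I)

/-! ### The value of the second stage in one tool set -/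

/-- The smallest worst-case second-stage cost in a tool set. -/
noncomputable def worst (l : Fin ℓ) : ℝ := (I.T l).inf' (I.T_nonempty l) (I.c + I.d)

variable {I}

theorem worst_le (hj : j ∈ I.T l) : I.worst l ≤ I.c j + I.d j :=
  Finset.inf'_le (I.c + I.d) hj

theorem exists_worst_eq (l : Fin ℓ) : ∃ j ∈ I.T l, I.c j + I.d j = I.worst l := by
  obtain ⟨j, hj, h⟩ := Finset.exists_mem_eq_inf' (I.T_nonempty l) (I.c + I.d)
  exact ⟨j, hj, h.symm⟩

/-- Deviations are nonnegative, so the cutoff at `worst` never removes the nominally cheapest tool.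
Hence `cheapest q l` is nonempty for `q ≥ 1`. -/
theorem c_le_worst_of_rank_eq_zero (hj : j ∈ I.T l) (h : I.rank I.c j = 0) :
    I.c j ≤ I.worst l := by
  obtain ⟨i, hi, hi'⟩ := I.exists_worst_eq l
  have h1 : I.c j ≤ I.c i :=
    weight_le_of_rank_eq_zero ((I.mem_T.1 hj).trans (I.mem_T.1 hi).symm) h
  linarith [I.d_nonneg i]

variable (I)

open Classical in
/-- The `q` nominally cheapest tools of a tool set, without those which are more expensive than
`worst`. -/
noncomputable def cheapest (q : ℕ) (l : Fin ℓ) : Finset (Fin n) :=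
  (I.T l).filter fun j => I.rank I.c j < q ∧ I.c j ≤ I.worst l

/-- The total distance from `worst` of the costs in `cheapest`. -/
noncomputable def gain (q : ℕ) (l : Fin ℓ) : ℝ := ∑ j ∈ I.cheapest q l, (I.worst l - I.c j)

/-- The least cost of a unit packing in `T_l` for `π = 1 / q`; the case `q = 0` stands for
`π = 0`. -/
noncomputable def unitCost (q : ℕ) (l : Fin ℓ) : ℝ := I.worst l - I.gain q l / q

/-- The deviation that is needed to raise all costs in `T_l` to the level `t`. -/
noncomputable def lift (l : Fin ℓ) (t : ℝ) : ℝ := ∑ j ∈ I.T l, max (t - I.c j) 0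

/-- The levels at which `q` is a slope of `lift`. -/
def IsLevel (q : ℕ) (l : Fin ℓ) (t : ℝ) : Prop :=
  t ≤ I.worst l ∧ (∀ j ∈ I.T l, q ≤ I.rank I.c j → t ≤ I.c j) ∧
  (t = I.worst l ∨ (q ≤ (I.T l).card ∧ ∀ j ∈ I.T l, I.rank I.c j < q → I.c j ≤ t))

variable {I}

theorem unitCost_zero (l : Fin ℓ) : I.unitCost 0 l = I.worst l := by
  simp [unitCost]

/-- Only tools of rank below `q` can lie strictly below `t`. If `t` is not `worst`, there are
exactly `q` such ranks and all these tools are at or below `t`, so every positive part is resolved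
and `lift` is affine with slope `q`. If `t` is `worst`, there may be fewer than `q` cheap tools, but
then `lift` is `gain` itself. -/
theorem lift_eq_of_isLevel {q : ℕ} (hq : 1 ≤ q) {t : ℝ} (ht : I.IsLevel q l t) :
    I.lift l t = q * (t - I.unitCost q l) := by
  classical
  have hq0 : (q : ℝ) ≠ 0 := by positivity
  obtain ⟨h1, h2, h3⟩ := ht
  have hl : I.lift l t
      = ∑ j ∈ (I.T l).filter (fun j => I.rank I.c j < q), max (t - I.c j) 0 := by
    rw [lift, Finset.sum_filter]
    refine Finset.sum_congr rfl fun j hj => ?_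
    split_ifs with h
    · rfl
    · exact max_eq_right (by linarith [h2 j hj (not_lt.1 h)])
  have hg : I.gain q l
      = ∑ j ∈ (I.T l).filter (fun j => I.rank I.c j < q), max (I.worst l - I.c j) 0 := by
    rw [gain, cheapest, ← Finset.filter_filter, Finset.sum_filter]
    refine Finset.sum_congr rfl fun j hj => ?_
    split_ifs with h
    · exact (max_eq_left (by linarith)).symm
    · exact (max_eq_right (by linarith)).symm
  rcases h3 with rfl | ⟨hc, h3⟩
  · rw [hl, ← hg, unitCost]
    field_simp
    ring
  · have e1 : I.lift l t = ∑ j ∈ (I.T l).filter (fun j => I.rank I.c j < q), (t - I.c j) := by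
      rw [hl]
      refine Finset.sum_congr rfl fun j hj => max_eq_left ?_
      obtain ⟨hj1, hj2⟩ := Finset.mem_filter.1 hj
      linarith [h3 j hj1 hj2]
    have e2 : I.gain q l
        = ∑ j ∈ (I.T l).filter (fun j => I.rank I.c j < q), (I.worst l - I.c j) := by
      rw [hg]
      refine Finset.sum_congr rfl fun j hj => max_eq_left ?_
      obtain ⟨hj1, hj2⟩ := Finset.mem_filter.1 hj
      linarith [h3 j hj1 hj2]
    rw [Finset.sum_sub_distrib, Finset.sum_const, card_rank_lt I.c hc, nsmul_eq_mul] at e1 e2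
    rw [e1, unitCost, e2]
    field_simp
    ring

variable (I)

open Classical in
/-- The `q`-th smallest nominal cost in `T_l`, cut off at `worst`. -/
noncomputable def level (q : ℕ) (l : Fin ℓ) : ℝ :=
  (insert (I.worst l) (((I.T l).filter fun j => q ≤ I.rank I.c j + 1).image I.c)).min'
    (Finset.insert_nonempty _ _)

variable {I}

theorem level_le_worst (q : ℕ) (l : Fin ℓ) : I.level q l ≤ I.worst l := by
  classical
  exact Finset.min'_le _ _ (Finset.mem_insert_self _ _)

theorem level_le {q : ℕ} (hj : j ∈ I.T l) (h : q ≤ I.rank I.c j + 1) :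
    I.level q l ≤ I.c j := by
  classical
  exact Finset.min'_le _ _ (Finset.mem_insert_of_mem
    (Finset.mem_image_of_mem _ (Finset.mem_filter.2 ⟨hj, h⟩)))

theorem level_cases (q : ℕ) (l : Fin ℓ) : I.level q l = I.worst l ∨
    ∃ j ∈ I.T l, q ≤ I.rank I.c j + 1 ∧ I.level q l = I.c j := by
  classical
  have := Finset.min'_mem (insert (I.worst l)
    (((I.T l).filter fun j => q ≤ I.rank I.c j + 1).image I.c)) (Finset.insert_nonempty _ _)
  rcases Finset.mem_insert.1 this with h | h
  · exact Or.inl h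
  · obtain ⟨j, hj, h⟩ := Finset.mem_image.1 h
    obtain ⟨h1, h2⟩ := Finset.mem_filter.1 hj
    exact Or.inr ⟨j, h1, h2, h.symm⟩

theorem level_le_level_succ (q : ℕ) (l : Fin ℓ) : I.level q l ≤ I.level (q + 1) l := by
  rcases I.level_cases (q + 1) l with h | ⟨j, hj, h1, h2⟩
  · rw [h]; exact level_le_worst q l
  · rw [h2]; exact level_le hj (by omega)

theorem isLevel_level (q : ℕ) (l : Fin ℓ) : I.IsLevel q l (I.level q l) := by
  refine ⟨level_le_worst q l, fun j hj h => level_le hj (by omega), ?_⟩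
  rcases I.level_cases q l with h | ⟨i, hi, h1, h2⟩
  · exact Or.inl h
  · refine Or.inr ⟨?_, fun j hj h => ?_⟩
    · have := rank_lt_card (w := I.c) hi
      omega
    · rw [h2]
      exact weight_le_of_rank_le ((I.mem_T.1 hj).trans (I.mem_T.1 hi).symm) (by omega)

/-- Ranks start at zero, so `level (q + 1)` is the cost of the tool of rank `q`, the first one not
counted by slope `q`. Together with `isLevel_level`, slope `q` is valid at both ends of the segment
from `level q` to `level (q + 1)`. -/
theorem isLevel_level_succ (q : ℕ) (l : Fin ℓ) : I.IsLevel q l (I.level (q + 1) l) := by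
  refine ⟨level_le_worst _ l, fun j hj h => level_le hj (by omega), ?_⟩
  rcases I.level_cases (q + 1) l with h | ⟨i, hi, h1, h2⟩
  · exact Or.inl h
  · refine Or.inr ⟨?_, fun j hj h => ?_⟩
    · have := rank_lt_card (w := I.c) hi
      omega
    · rw [h2]
      exact weight_le_of_rank_le ((I.mem_T.1 hj).trans (I.mem_T.1 hi).symm) (by omega)

/-- The upper bounds on the level are inherited from `b` and the lower bounds from `a`; if `a` is
already `worst`, the segment is a single point. -/
theorem IsLevel.interpolate {q : ℕ} {a b r : ℝ} (ha : I.IsLevel q l a) (hb : I.IsLevel q l b)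
    (hab : a ≤ b) (hr : 0 ≤ r) (hr' : r ≤ 1) : I.IsLevel q l (a + r * (b - a)) := by
  have h1 : a + r * (b - a) ≤ b := by nlinarith
  have h2 : a ≤ a + r * (b - a) := by nlinarith
  refine ⟨h1.trans hb.1, fun j hj h => h1.trans (hb.2.1 j hj h), ?_⟩
  rcases ha.2.2 with h | ⟨h, h'⟩
  · left
    have := hb.1
    linarith
  · exact Or.inr ⟨h, fun j hj hq => (h' j hj hq).trans h2⟩

theorem lift_level_one (l : Fin ℓ) : I.lift l (I.level 1 l) = 0 :=
  Finset.sum_eq_zero fun j hj => max_eq_right (by linarith [I.level_le (q := 1) hj (by omega)])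

theorem level_eq_worst (l : Fin ℓ) : I.level (n + 1) l = I.worst l := by
  rcases I.level_cases (n + 1) l with h | ⟨j, hj, h1, h2⟩
  · exact h
  · have := I.rank_lt I.c j
    omega

end RSInstance

end RTSt

namespace RTSt

namespace RSInstance

variable {n ℓ : ℕ} (I : RSInstance n ℓ)

/-! ### Duality for a fixed first stage -/

/-- The part of the objective function of the mixed-integer program without the first stage. -/
noncomputable def secondCost (u v : Fin n → ℝ) (π : ℝ) : ℝ :=
  ∑ j, I.c j * u j + I.Γ * π + ∑ j, (I.c j + I.d j) * v j

/-- The least second-stage cost for `π = 1 / q` (or `π = 0` if `q = 0`) when the tool sets with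
`z l = 0` are left to the second stage. -/
noncomputable def stageCost (z : Fin ℓ → ℝ) (q : ℕ) : ℝ :=
  I.Γ * (1 / q) + ∑ l, (1 - z l) * I.unitCost q l

variable {I}

theorem sum_eq_sum_T (f : Fin n → ℝ) : ∑ j, f j = ∑ l, ∑ j ∈ I.T l, f j :=
  (Finset.sum_fiberwise Finset.univ I.label f).symm

theorem secondCost_eq (u v : Fin n → ℝ) (π : ℝ) :
    I.secondCost u v π = I.Γ * π + ∑ l, I.packCost u v l := by
  simp only [secondCost, packCost, ← sum_eq_sum_T, Finset.sum_add_distrib]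
  ring

theorem obj_eq (x : Fin ℓ → ℝ) (u v : Fin n → ℝ) (π : ℝ) :
    I.obj x u v π = ∑ l, I.Chat l * x l + I.secondCost u v π := by
  simp only [obj, secondCost]
  ring

/-- Weak duality. -/
theorem sum_level_le_secondCost {z : Fin ℓ → ℝ} (hz : Binary z) {u v : Fin n → ℝ} {π : ℝ}
    (hp : (u, v, π) ∈ I.polytope z) {s : Fin n → ℝ} (hs : s ∈ I.U) {t : Fin ℓ → ℝ}
    (ht : ∀ l, z l = 0 → ∀ j ∈ I.T l, t l ≤ s j) :
    ∑ l, (1 - z l) * t l ≤ I.secondCost u v π := by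
  obtain ⟨h1, h2, h3, h4, h5⟩ := hp
  obtain ⟨δ, hδ, hΓ, rfl⟩ := hs
  simp only at h1 h2 h3 h4 h5
  have hδΓ : ∑ j, δ j ≤ I.Γ :=
    (Finset.sum_le_sum fun j _ => le_abs_self (δ j)).trans hΓ
  -- In an open set the weights `u + v` sum to one, so the level is at most the weighted mean of the
  -- costs. In the other sets the left side vanishes and the right side is nonnegative.
  have key : ∀ l, (1 - z l) * t l ≤ ∑ j ∈ I.T l, (I.c j + δ j) * (u j + v j) := by
    intro l
    rcases hz l with h | h
    · have : (1 - z l) * t l = ∑ j ∈ I.T l, t l * (u j + v j) := by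
        rw [← Finset.mul_sum, ← h1 l]; ring
      rw [this]
      refine Finset.sum_le_sum fun j hj => ?_
      have := ht l h j hj
      exact mul_le_mul_of_nonneg_right (by simpa using this) (by linarith [h2 j, h3 j])
    · rw [h, sub_self, zero_mul]
      refine Finset.sum_nonneg fun j _ => mul_nonneg ?_ ?_
      · linarith [I.c_nonneg j, hδ j]
      · linarith [h2 j, h3 j]
  calc ∑ l, (1 - z l) * t l ≤ ∑ l, ∑ j ∈ I.T l, (I.c j + δ j) * (u j + v j) :=
        Finset.sum_le_sum fun l _ => key l
    _ = ∑ j, (I.c j + δ j) * (u j + v j) := (sum_eq_sum_T _).symm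
    -- The deviation is bounded in two ways: on `u` through `u j ≤ π`, which charges it to the
    -- budget, and on `v` through `δ j ≤ d j`.
    _ ≤ ∑ j, (I.c j * u j + δ j * π + (I.c j + I.d j) * v j) := by
        refine Finset.sum_le_sum fun j _ => ?_
        have e1 : δ j * u j ≤ δ j * π := mul_le_mul_of_nonneg_left (h2 j).2 (hδ j).1
        have e2 : δ j * v j ≤ I.d j * v j := mul_le_mul_of_nonneg_right (hδ j).2 (h3 j).1
        nlinarith
    _ = ∑ j, I.c j * u j + (∑ j, δ j) * π + ∑ j, (I.c j + I.d j) * v j := by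
        rw [Finset.sum_add_distrib, Finset.sum_add_distrib, Finset.sum_mul]
    _ ≤ I.secondCost u v π := by
        have := mul_le_mul_of_nonneg_right hδΓ h4
        rw [secondCost]
        linarith

/-- Raise each tool of an open set just to the level `t l` and leave all other costs nominal. The
deviations are admissible because `t l ≤ worst l ≤ c j + d j`. -/
theorem exists_scenario_of_lift {z : Fin ℓ → ℝ} (hz : Binary z) {t : Fin ℓ → ℝ}
    (ht : ∀ l, t l ≤ I.worst l) (hΓ : ∑ l, (1 - z l) * I.lift l (t l) ≤ I.Γ) :
    ∃ s ∈ I.U, ∀ l, z l = 0 → ∀ j ∈ I.T l, t l ≤ s j := by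
  have hz0 : ∀ l, 0 ≤ 1 - z l ∧ 1 - z l ≤ 1 := by
    intro l; rcases hz l with h | h <;> rw [h] <;> norm_num
  set δ : Fin n → ℝ := fun j => (1 - z (I.label j)) * max (t (I.label j) - I.c j) 0 with hδ
  have hδ0 : ∀ j, 0 ≤ δ j := fun j => mul_nonneg (hz0 _).1 (le_max_right _ _)
  refine ⟨I.c + δ, ⟨δ, fun j => ⟨hδ0 j, ?_⟩, ?_, rfl⟩, ?_⟩
  · have hm : max (t (I.label j) - I.c j) 0 ≤ I.d j := by
      refine max_le ?_ (I.d_nonneg j)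
      have := worst_le (I.mem_T.2 rfl : j ∈ I.T (I.label j))
      linarith [ht (I.label j)]
    calc δ j ≤ 1 * max (t (I.label j) - I.c j) 0 :=
          mul_le_mul_of_nonneg_right (hz0 _).2 (le_max_right _ _)
      _ ≤ I.d j := by rwa [one_mul]
  · refine le_trans (le_of_eq ?_) hΓ
    rw [sum_eq_sum_T (I := I)]
    refine Finset.sum_congr rfl fun l _ => ?_
    rw [lift, Finset.mul_sum]
    refine Finset.sum_congr rfl fun j hj => ?_
    rw [abs_of_nonneg (hδ0 j), hδ]
    simp only [I.mem_T.1 hj]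
  · intro l hl j hj
    simp only [Pi.add_apply, hδ, I.mem_T.1 hj, hl, sub_zero, one_mul]
    linarith [le_max_left (t l - I.c j) 0]

/-- Strong duality: the second-stage cost of some `q` is attained by a scenario. -/
theorem exists_scenario {z : Fin ℓ → ℝ} (hz : Binary z) :
    ∃ q ≤ n, ∃ s ∈ I.U, ∃ t : Fin ℓ → ℝ, (∀ l, z l = 0 → ∀ j ∈ I.T l, t l ≤ s j) ∧
      I.stageCost z q = ∑ l, (1 - z l) * t l := by
  set H : ℕ → ℝ := fun q => ∑ l, (1 - z l) * I.lift l (I.level q l) with hH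
  have hH1 : H 1 = 0 := by simp [hH, lift_level_one]
  by_cases hn : H (n + 1) ≤ I.Γ
  -- The budget suffices to raise every open set to `worst`, so budget has price zero, encoded by `q
  -- = 0`.
  · obtain ⟨s, hs, hst⟩ := exists_scenario_of_lift hz (fun l => level_le_worst (n + 1) l) hn
    refine ⟨0, Nat.zero_le _, s, hs, _, hst, ?_⟩
    simp [stageCost, unitCost_zero, level_eq_worst]
  have hex : ∃ q, I.Γ < H (q + 1) := ⟨n, not_le.1 hn⟩
  classical
  -- The first slope during which the budget is exhausted. It is at least 1, since `H 1 = 0 ≤ Γ`.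
  obtain ⟨q, hq, hmin⟩ : ∃ q, I.Γ < H (q + 1) ∧ ∀ p < q, H (p + 1) ≤ I.Γ :=
    ⟨Nat.find hex, Nat.find_spec hex, fun p hp => not_lt.1 (Nat.find_min hex hp)⟩
  have hqn : q ≤ n := by
    by_contra hcon
    exact hn (hmin n (by omega))
  have hq1 : 1 ≤ q := by
    by_contra hcon
    obtain rfl : q = 0 := by omega
    rw [zero_add, hH1] at hq
    exact absurd I.Γ_nonneg (not_le.2 hq)
  have hlow : H q ≤ I.Γ := by
    have := hmin (q - 1) (by omega)
    rwa [Nat.sub_add_cancel hq1] at this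
  set r : ℝ := (I.Γ - H q) / (H (q + 1) - H q) with hr
  have hpos : 0 < H (q + 1) - H q := by linarith
  have hr0 : 0 ≤ r := div_nonneg (by linarith) hpos.le
  have hr1 : r ≤ 1 := (div_le_one hpos).2 (by linarith)
  have hrm : r * (H (q + 1) - H q) = I.Γ - H q := by
    rw [hr]; field_simp
  -- The same fraction `r` is used in all sets. Each `lift` is affine on its segment, so the total
  -- demand is the interpolation of `H q` and `H (q + 1)`, which is Γ by the choice of `r`.
  set t : Fin ℓ → ℝ := fun l => I.level q l + r * (I.level (q + 1) l - I.level q l) with ht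
  have hlev : ∀ l, I.IsLevel q l (t l) := fun l =>
    (isLevel_level q l).interpolate (isLevel_level_succ q l) (level_le_level_succ q l) hr0 hr1
  have hlift : ∑ l, (1 - z l) * I.lift l (t l) = I.Γ := by
    have : ∑ l, (1 - z l) * I.lift l (t l) = H q + r * (H (q + 1) - H q) := by
      simp only [hH]
      rw [← Finset.sum_sub_distrib, Finset.mul_sum, ← Finset.sum_add_distrib]
      refine Finset.sum_congr rfl fun l _ => ?_
      rw [lift_eq_of_isLevel hq1 (hlev l), lift_eq_of_isLevel hq1 (isLevel_level q l),
        lift_eq_of_isLevel hq1 (isLevel_level_succ q l)]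
      simp only [ht]
      ring
    rw [this, hrm]; ring
  obtain ⟨s, hs, hst⟩ := exists_scenario_of_lift hz (fun l => (hlev l).1) hlift.le
  refine ⟨q, hqn, s, hs, t, hst, ?_⟩
  have hq0 : (q : ℝ) ≠ 0 := by positivity
  rw [stageCost, ← hlift, Finset.sum_mul, ← Finset.sum_add_distrib]
  refine Finset.sum_congr rfl fun l _ => ?_
  rw [lift_eq_of_isLevel hq1 (hlev l)]
  field_simp
  ring

/-! ### Packings -/

variable (I)

/-- A tool with the smallest worst-case cost. -/
noncomputable def worstTool (l : Fin ℓ) : Fin n := (I.exists_worst_eq l).choose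

/-- The part of the optimal packing for `π = 1 / q` in the variables `u`. -/
noncomputable def packU (z : Fin ℓ → ℝ) (q : ℕ) (j : Fin n) : ℝ :=
  open Classical in
  (1 - z (I.label j)) * if j ∈ I.cheapest q (I.label j) then 1 / (q : ℝ) else 0

/-- The part of the optimal packing for `π = 1 / q` in the variables `v`. -/
noncomputable def packV (z : Fin ℓ → ℝ) (q : ℕ) (j : Fin n) : ℝ :=
  (1 - z (I.label j)) * if j = I.worstTool (I.label j)
    then 1 - (I.cheapest q (I.label j)).card / (q : ℝ) else 0

variable {I} {l : Fin ℓ}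

theorem worstTool_mem (l : Fin ℓ) : I.worstTool l ∈ I.T l := (I.exists_worst_eq l).choose_spec.1

theorem cost_worstTool (l : Fin ℓ) :
    I.c (I.worstTool l) + I.d (I.worstTool l) = I.worst l :=
  (I.exists_worst_eq l).choose_spec.2

theorem cheapest_subset (q : ℕ) (l : Fin ℓ) : I.cheapest q l ⊆ I.T l := by
  classical
  exact Finset.filter_subset _ _

theorem mem_cheapest {q : ℕ} {j : Fin n} :
    j ∈ I.cheapest q l ↔ j ∈ I.T l ∧ I.rank I.c j < q ∧ I.c j ≤ I.worst l := by
  classical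
  exact Finset.mem_filter

theorem card_cheapest_le (q : ℕ) (l : Fin ℓ) : (I.cheapest q l).card ≤ q := by
  refine (Finset.card_le_card fun j hj => ?_).trans (I.card_rank_lt_le I.c l q)
  obtain ⟨h1, h2, -⟩ := mem_cheapest.1 hj
  exact Finset.mem_filter.2 ⟨h1, h2⟩

theorem one_le_card_cheapest {q : ℕ} (hq : 1 ≤ q) (l : Fin ℓ) : 1 ≤ (I.cheapest q l).card := by
  obtain ⟨j, hj, h⟩ := I.exists_rank_eq_zero I.c l
  exact Finset.card_pos.2 ⟨j, mem_cheapest.2 ⟨hj, by omega, c_le_worst_of_rank_eq_zero hj h⟩⟩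

theorem sum_T_packU (z : Fin ℓ → ℝ) (q : ℕ) (f : Fin n → ℝ) (l : Fin ℓ) :
    ∑ j ∈ I.T l, f j * I.packU z q j
      = (1 - z l) * (∑ j ∈ I.cheapest q l, f j) * (1 / (q : ℝ)) := by
  classical
  have h : ∀ j ∈ I.T l, f j * I.packU z q j
      = if j ∈ I.cheapest q l then (1 - z l) * (f j * (1 / (q : ℝ))) else 0 := by
    intro j hj
    rw [packU, I.mem_T.1 hj]
    split_ifs <;> ring
  rw [Finset.sum_congr rfl h, ← Finset.sum_filter,
    Finset.filter_mem_eq_inter, Finset.inter_eq_right.2 (cheapest_subset q l),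
    mul_assoc, Finset.sum_mul, Finset.mul_sum]

theorem sum_T_packV (z : Fin ℓ → ℝ) (q : ℕ) (f : Fin n → ℝ) (l : Fin ℓ) :
    ∑ j ∈ I.T l, f j * I.packV z q j
      = (1 - z l) * f (I.worstTool l) * (1 - (I.cheapest q l).card / (q : ℝ)) := by
  have h : ∀ j ∈ I.T l, f j * I.packV z q j = if j = I.worstTool l
      then (1 - z l) * f (I.worstTool l) * (1 - (I.cheapest q l).card / (q : ℝ)) else 0 := by
    intro j hj
    rw [packV, I.mem_T.1 hj]
    split_ifs with h1
    · rw [h1]; ring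
    · ring
  rw [Finset.sum_congr rfl h, Finset.sum_ite_eq', if_pos (worstTool_mem l)]

/-- The capacity `1 - π` of `v` is respected because at least one cheap tool takes a share `1 / q`
of the unit. For `q = 0` the convention `x / 0 = 0` makes `π = 0` and puts the whole unit on
`worstTool`. -/
theorem pack_mem_polytope {z : Fin ℓ → ℝ} (hz : Binary z) (q : ℕ) :
    (I.packU z q, I.packV z q, 1 / (q : ℝ)) ∈ I.polytope z := by
  classical
  have hz0 : ∀ l, 0 ≤ 1 - z l ∧ 1 - z l ≤ 1 := by
    intro l; rcases hz l with h | h <;> rw [h] <;> norm_num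
  have hπ : 0 ≤ 1 / (q : ℝ) := by positivity
  have hπ1 : 1 / (q : ℝ) ≤ 1 := by
    rcases Nat.eq_zero_or_pos q with rfl | h
    · simp
    · exact (div_le_one (by positivity)).2 (by exact_mod_cast h)
  have hscale : ∀ (l : Fin ℓ) (a b : ℝ), 0 ≤ a → a ≤ b →
      0 ≤ (1 - z l) * a ∧ (1 - z l) * a ≤ b := by
    intro l a b ha hab
    exact ⟨mul_nonneg (hz0 l).1 ha,
      (mul_le_mul_of_nonneg_right (hz0 l).2 ha).trans ((one_mul a).trans_le hab)⟩
  refine ⟨fun l => ?_, fun j => ?_, fun j => ?_, hπ, hπ1⟩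
  · have e1 := I.sum_T_packU z q (fun _ => 1) l
    have e2 := I.sum_T_packV z q (fun _ => 1) l
    simp only [one_mul, Finset.sum_const, nsmul_eq_mul, mul_one] at e1 e2
    rw [Finset.sum_add_distrib, e1, e2]
    ring
  · refine hscale _ _ _ ?_ ?_ <;> split_ifs <;> first | exact hπ | exact le_rfl
  · refine hscale _ _ _ ?_ ?_
    · split_ifs
      · have : ((I.cheapest q (I.label j)).card : ℝ) / q ≤ 1 :=
          div_le_one_of_le₀ (by exact_mod_cast card_cheapest_le q _) (Nat.cast_nonneg q)
        linarith
      · exact le_rfl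
    · split_ifs
      · rcases Nat.eq_zero_or_pos q with rfl | h
        · simp
        · have : (1 : ℝ) ≤ (I.cheapest q (I.label j)).card := by
            exact_mod_cast one_le_card_cheapest h _
          have := div_le_div_of_nonneg_right this (Nat.cast_nonneg q : (0 : ℝ) ≤ q)
          linarith
      · linarith

theorem secondCost_pack (z : Fin ℓ → ℝ) (q : ℕ) :
    I.secondCost (I.packU z q) (I.packV z q) (1 / (q : ℝ)) = I.stageCost z q := by
  rw [secondCost_eq, stageCost]
  congr 1
  refine Finset.sum_congr rfl fun l _ => ?_
  rw [packCost, Finset.sum_add_distrib, sum_T_packU, sum_T_packV, cost_worstTool, unitCost, gain,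
    Finset.sum_sub_distrib, Finset.sum_const, nsmul_eq_mul]
  ring

end RSInstance

end RTSt

namespace RTSt

namespace RSInstance

variable {n ℓ : ℕ} {I : RSInstance n ℓ}

/-! ### Evaluation of a first-stage solution -/

theorem Chat_le {j : Fin n} {l : Fin ℓ} (hj : j ∈ I.T l) : I.Chat l ≤ I.C j :=
  Finset.inf'_le I.C hj

theorem binary_sum_T {x : Fin n → ℝ} (hx : x ∈ partialSolutions I.X) :
    Binary fun l => ∑ j ∈ I.T l, x j := by
  obtain ⟨hb, y, hy, hxy⟩ := hx
  intro l
  have h0 : ∀ j, 0 ≤ x j := fun j => by rcases hb j with h | h <;> rw [h]; norm_num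
  have h0' : ∀ j, 0 ≤ y j := fun j => by rcases hy j with h | h <;> rw [h]; norm_num
  have h1 : ∑ j ∈ I.T l, x j ≤ 1 := by
    have := hxy.2 l
    simp only [Pi.add_apply, Finset.sum_add_distrib] at this
    linarith [Finset.sum_nonneg fun j (_ : j ∈ I.T l) => h0' j]
  by_cases h : ∀ j ∈ I.T l, x j = 0
  · exact Or.inl (Finset.sum_eq_zero h)
  · push Not at h
    obtain ⟨j, hj, hne⟩ := h
    right
    refine le_antisymm h1 ?_
    rw [← (hb j).resolve_left hne]
    exact Finset.single_le_sum (fun i _ => h0 i) hj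

/-- The best recourse takes the cheapest tool of each open set, and `t` records these costs. Its
maximality among admissible levels allows comparison with the levels supplied by strong duality. -/
theorem isRecourseValue {x : Fin n → ℝ} (hx : x ∈ partialSolutions I.X) (s : Fin n → ℝ) :
    ∃ t : Fin ℓ → ℝ, (∀ l, ∀ j ∈ I.T l, t l ≤ s j) ∧
      (∀ t' : Fin ℓ → ℝ, (∀ l, ∑ j ∈ I.T l, x j = 0 → ∀ j ∈ I.T l, t' l ≤ s j) →
        ∑ l, (1 - ∑ j ∈ I.T l, x j) * t' l ≤ ∑ l, (1 - ∑ j ∈ I.T l, x j) * t l) ∧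
      IsRecourseValue I.X I.C x s (∑ j, I.C j * x j + ∑ l, (1 - ∑ j ∈ I.T l, x j) * t l) := by
  have hz := binary_sum_T hx
  have hb := hx.1
  have h0 : ∀ j, 0 ≤ x j := fun j => by rcases hb j with h | h <;> rw [h]; norm_num
  choose a ha hat using fun l => Finset.exists_min_image (I.T l) s (I.T_nonempty l)
  refine ⟨fun l => s (a l), hat, fun t' ht' => ?_, ?_, ?_⟩
  · refine Finset.sum_le_sum fun l _ => ?_
    rcases hz l with h | h
    · simp only at h
      rw [h]
      simpa using ht' l h (a l) (ha l)
    · simp only at h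
      rw [h, sub_self, zero_mul, zero_mul]
  · set y : Fin n → ℝ := fun j =>
      (1 - ∑ i ∈ I.T (I.label j), x i) * if j = a (I.label j) then 1 else 0 with hy
    have hsum : ∀ (f : Fin n → ℝ) l, ∑ j ∈ I.T l, f j * y j
        = (1 - ∑ j ∈ I.T l, x j) * f (a l) := by
      intro f l
      have h : ∀ j ∈ I.T l, f j * y j
          = if j = a l then (1 - ∑ j ∈ I.T l, x j) * f (a l) else 0 := by
        intro j hj
        simp only [hy, I.mem_T.1 hj]
        split_ifs with h1
        · rw [h1]; ring
        · ring
      rw [Finset.sum_congr rfl h, Finset.sum_ite_eq', if_pos (ha l)]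
    refine ⟨y, ⟨fun j => ?_, fun j => ?_, fun l => ?_⟩, ?_⟩
    · simp only [hy]
      rcases hz (I.label j) with h | h <;> simp only at h <;> rw [h] <;> split_ifs <;> norm_num
    · simp only [Pi.add_apply, hy]
      rcases hz (I.label j) with h | h <;> simp only at h
      · have hxj : x j = 0 :=
          (Finset.sum_eq_zero_iff_of_nonneg fun i _ => h0 i).1 h j (I.mem_T.2 rfl)
        rw [h, hxj]
        split_ifs <;> norm_num
      · rw [h, sub_self, zero_mul, add_zero]
        exact hb j
    · have := hsum (fun _ => 1) l
      simp only [one_mul, mul_one] at this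
      simp only [Pi.add_apply, Finset.sum_add_distrib, this]
      ring
    · simp only [sum_eq_sum_T (I := I) fun j => s j * y j, hsum]
  · rintro _ ⟨y, ⟨hyb, hxy⟩, rfl⟩
    have hy0 : ∀ j, 0 ≤ y j := fun j => by rcases hyb j with h | h <;> rw [h]; norm_num
    simp only [sum_eq_sum_T (I := I) fun j => s j * y j, add_le_add_iff_left]
    refine Finset.sum_le_sum fun l _ => ?_
    have : 1 - ∑ j ∈ I.T l, x j = ∑ j ∈ I.T l, y j := by
      have := hxy.2 l
      simp only [Pi.add_apply, Finset.sum_add_distrib] at this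
      linarith
    rw [this, Finset.sum_mul]
    refine Finset.sum_le_sum fun j hj => ?_
    rw [mul_comm (s j)]
    exact mul_le_mul_of_nonneg_left (hat l j hj) (hy0 j)

/-- The worst case of a first-stage solution is the optimal value of the linear program that is
left when the first stage is fixed, and it is attained for some `π = 1 / q`. -/
theorem exists_isEval {x : Fin n → ℝ} (hx : x ∈ partialSolutions I.X) :
    ∃ q ≤ n, IsEval I.X I.U I.C x
      (∑ j, I.C j * x j + I.stageCost (fun l => ∑ j ∈ I.T l, x j) q) ∧
      ∀ p, I.stageCost (fun l => ∑ j ∈ I.T l, x j) q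
        ≤ I.stageCost (fun l => ∑ j ∈ I.T l, x j) p := by
  have hz := binary_sum_T hx
  obtain ⟨q, hq, s, hs, t, ht, hst⟩ := I.exists_scenario hz
  have hweak : ∀ p, ∀ s' ∈ I.U, ∀ t' : Fin ℓ → ℝ,
      (∀ l, ∑ j ∈ I.T l, x j = 0 → ∀ j ∈ I.T l, t' l ≤ s' j) →
      ∑ l, (1 - ∑ j ∈ I.T l, x j) * t' l ≤ I.stageCost (fun l => ∑ j ∈ I.T l, x j) p := by
    intro p s' hs' t' ht'
    rw [← secondCost_pack]
    exact sum_level_le_secondCost hz (pack_mem_polytope hz p) hs' ht'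
  refine ⟨q, hq, ⟨⟨s, hs, ?_⟩, ?_⟩, fun p => hst.trans_le (hweak p s hs t ht)⟩
  · obtain ⟨τ, hτ, hτmax, hval⟩ := isRecourseValue hx s
    convert hval using 2
    -- The recourse value of the dual scenario is at least the sum of its levels, and weak duality
    -- bounds it by the same number.
    exact le_antisymm (hst.trans_le (hτmax t ht)) (hweak q s hs τ fun l _ => hτ l)
  · rintro w ⟨s', hs', hw⟩
    obtain ⟨τ, hτ, -, hval⟩ := isRecourseValue hx s'
    rw [hw.unique hval, add_le_add_iff_left]
    exact hweak q s' hs' τ fun l _ => hτ l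

/-! ### First-stage solutions from choices of tool sets -/

theorem sum_T_select {rep : Fin ℓ → Fin n} (hrep : ∀ l, rep l ∈ I.T l) (z : Fin ℓ → ℝ)
    (f : Fin n → ℝ) (l : Fin ℓ) :
    ∑ j ∈ I.T l, f j * (if j = rep (I.label j) then z (I.label j) else 0)
      = f (rep l) * z l := by
  have h : ∀ j ∈ I.T l, f j * (if j = rep (I.label j) then z (I.label j) else 0)
      = if j = rep l then f (rep l) * z l else 0 := by
    intro j hj
    rw [I.mem_T.1 hj]
    split_ifs with h1
    · rw [h1]
    · ring
  rw [Finset.sum_congr rfl h, Finset.sum_ite_eq', if_pos (hrep l)]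

theorem select_mem_partialSolutions {rep : Fin ℓ → Fin n} (hrep : ∀ l, rep l ∈ I.T l)
    {z : Fin ℓ → ℝ} (hz : Binary z) :
    (fun j => if j = rep (I.label j) then z (I.label j) else 0) ∈ partialSolutions I.X := by
  have key : ∀ {z : Fin ℓ → ℝ}, Binary z →
      Binary fun j => if j = rep (I.label j) then z (I.label j) else 0 := by
    intro z hz j
    dsimp only
    split_ifs
    · exact hz _
    · exact Or.inl rfl
  refine ⟨key hz, fun j => if j = rep (I.label j) then 1 - z (I.label j) else 0,
    key (z := fun l => 1 - z l) fun l => ?_, ?_⟩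
  · rcases hz l with h | h <;> simp [h]
  · have : ((fun j => if j = rep (I.label j) then z (I.label j) else 0)
        + fun j => if j = rep (I.label j) then 1 - z (I.label j) else 0)
        = fun j => if j = rep (I.label j) then (fun _ => (1 : ℝ)) (I.label j) else 0 := by
      funext j
      simp only [Pi.add_apply]
      split_ifs <;> ring
    rw [this]
    refine ⟨key (z := fun _ => 1) fun _ => Or.inr rfl, fun l => ?_⟩
    simpa using I.sum_T_select hrep (fun _ => 1) (fun _ => 1) l

variable (I)

/-- The cost of the first stage `z` together with the second stage for `π = 1 / q`. -/
noncomputable def totalCost (z : Fin ℓ → ℝ) (q : ℕ) : ℝ :=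
  ∑ l, I.Chat l * z l + I.stageCost z q

variable {I}

/-- The scenario from strong duality depends only on `z`; its levels bound every feasible `(u, v,
π)` from below, so arbitrary `π` cannot beat the values `1 / q`. -/
theorem exists_totalCost_le_obj {z : Fin ℓ → ℝ} {u v : Fin n → ℝ} {π : ℝ}
    (h : I.MIPFeasible z u v π) : ∃ q ≤ n, I.totalCost z q ≤ I.obj z u v π := by
  obtain ⟨q, hq, s, hs, t, ht, hst⟩ := I.exists_scenario h.1
  refine ⟨q, hq, ?_⟩
  rw [totalCost, obj_eq, hst, add_le_add_iff_left]
  exact sum_level_le_secondCost h.1 h.2 hs ht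

theorem exists_totalCost_le_eval {x : Fin n → ℝ} (hx : x ∈ partialSolutions I.X) {w : ℝ}
    (hw : IsEval I.X I.U I.C x w) :
    ∃ q ≤ n, I.totalCost (fun l => ∑ j ∈ I.T l, x j) q ≤ w := by
  obtain ⟨q, hq, he, -⟩ := exists_isEval hx
  refine ⟨q, hq, ?_⟩
  rw [hw.unique he, totalCost, add_le_add_iff_right, sum_eq_sum_T (I := I)]
  refine Finset.sum_le_sum fun l _ => ?_
  rw [Finset.mul_sum]
  refine Finset.sum_le_sum fun j hj => mul_le_mul_of_nonneg_right (Chat_le hj) ?_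
  rcases hx.1 j with h | h <;> rw [h]; norm_num

/-- A minimizer of `totalCost` solves the robust two-stage problem. -/
theorem isEval_select {z : Fin ℓ → ℝ} (hz : Binary z) {q : ℕ}
    (hmin : ∀ z', Binary z' → ∀ p ≤ n, I.totalCost z q ≤ I.totalCost z' p)
    {rep : Fin ℓ → Fin n} (hrep : ∀ l, rep l ∈ I.T l) (hC : ∀ l, I.C (rep l) = I.Chat l) :
    IsEval I.X I.U I.C (fun j => if j = rep (I.label j) then z (I.label j) else 0)
      (I.totalCost z q) := by
  obtain ⟨p, hp, he, hpmin⟩ := I.exists_isEval (I.select_mem_partialSolutions hrep hz)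
  have e1 : (fun l => ∑ j ∈ I.T l, if j = rep (I.label j) then z (I.label j) else 0) = z := by
    funext l
    simpa using I.sum_T_select hrep z (fun _ => 1) l
  have e2 : ∑ j, I.C j * (if j = rep (I.label j) then z (I.label j) else 0)
      = ∑ l, I.Chat l * z l := by
    rw [sum_eq_sum_T (I := I)]
    exact Finset.sum_congr rfl fun l _ => by rw [sum_T_select hrep, hC]
  rw [e1] at he hpmin
  rw [e2] at he
  -- The worst case of this first stage is attained at some `p`, possibly different from `q`; global
  -- minimality of `q` and optimality of `p` for `z` make the two costs equal.
  have : I.totalCost z q = I.totalCost z p :=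
    le_antisymm (hmin z hz p hp) ((add_le_add_iff_left _).2 (hpmin q))
  rw [this]
  exact he

theorem exists_tool_C_eq (I : RSInstance n ℓ) :
    ∃ rep : Fin ℓ → Fin n, (∀ l, rep l ∈ I.T l) ∧ ∀ l, I.C (rep l) = I.Chat l := by
  choose rep h1 h2 using fun l => Finset.exists_mem_eq_inf' (I.T_nonempty l) I.C
  exact ⟨rep, h1, fun l => (h2 l).symm⟩

theorem isOptimalValue_totalCost {z : Fin ℓ → ℝ} (hz : Binary z) {q : ℕ}
    (hmin : ∀ z', Binary z' → ∀ p ≤ n, I.totalCost z q ≤ I.totalCost z' p) :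
    IsOptimalValue I.X I.U I.C (I.totalCost z q) := by
  obtain ⟨rep, hrep, hC⟩ := I.exists_tool_C_eq
  refine ⟨⟨_, select_mem_partialSolutions hrep hz, isEval_select hz hmin hrep hC⟩, ?_⟩
  rintro w ⟨x, hx, hw⟩
  obtain ⟨p, hp, h⟩ := exists_totalCost_le_eval hx hw
  exact (hmin _ (binary_sum_T hx) p hp).trans h

/-! ### Exchanging the minima over first stages and over `q`. -/

variable (I)

/-- The least total cost for `π = 1 / q`. -/
noncomputable def leastCost (q : ℕ) : ℝ :=
  I.Γ * (1 / q) + ∑ l, min (I.Chat l) (I.unitCost q l)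

open Classical in
/-- The best first stage for `π = 1 / q`. -/
noncomputable def bestStage (q : ℕ) (l : Fin ℓ) : ℝ := if I.Chat l ≤ I.unitCost q l then 1 else 0

variable {I}

theorem binary_bestStage (q : ℕ) : Binary (I.bestStage q) := by
  intro l
  unfold bestStage
  split_ifs <;> simp

theorem totalCost_bestStage (q : ℕ) : I.totalCost (I.bestStage q) q = I.leastCost q := by
  have : ∑ l, min (I.Chat l) (I.unitCost q l) = ∑ l, I.Chat l * I.bestStage q l
      + ∑ l, (1 - I.bestStage q l) * I.unitCost q l := by
    rw [← Finset.sum_add_distrib]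
    refine Finset.sum_congr rfl fun l _ => ?_
    unfold bestStage
    split_ifs with h
    · rw [min_eq_left h]; ring
    · rw [min_eq_right (not_le.1 h).le]; ring
  rw [totalCost, stageCost, leastCost, this]
  ring

theorem leastCost_le_totalCost {z : Fin ℓ → ℝ} (hz : Binary z) (q : ℕ) :
    I.leastCost q ≤ I.totalCost z q := by
  have : ∑ l, min (I.Chat l) (I.unitCost q l) ≤ ∑ l, I.Chat l * z l
      + ∑ l, (1 - z l) * I.unitCost q l := by
    rw [← Finset.sum_add_distrib]
    refine Finset.sum_le_sum fun l _ => ?_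
    rcases hz l with h | h <;> rw [h] <;> simp
  rw [totalCost, stageCost, leastCost]
  linarith

theorem totalCost_bestStage_le {q : ℕ} (hq : ∀ p ≤ n, I.leastCost q ≤ I.leastCost p) :
    ∀ z', Binary z' → ∀ p ≤ n, I.totalCost (I.bestStage q) q ≤ I.totalCost z' p :=
  fun _ hz' p hp => (totalCost_bestStage q).trans_le
    ((hq p hp).trans (leastCost_le_totalCost hz' p))

theorem exists_leastCost_le (I : RSInstance n ℓ) :
    ∃ q ≤ n, ∀ p ≤ n, I.leastCost q ≤ I.leastCost p := by
  obtain ⟨q, hq, h⟩ := Finset.exists_min_image (Finset.range (n + 1)) I.leastCost ⟨0, by simp⟩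
  exact ⟨q, by simpa [Nat.lt_succ_iff] using hq, fun p hp => h p (by simpa [Nat.lt_succ_iff])⟩

end RSInstance

end RTSt

namespace RTSt

namespace RSInstance

variable {n ℓ : ℕ} {I : RSInstance n ℓ}

/-! ### Vertices -/

theorem eq_zero_of_openSegment {a b x y : ℝ} (ha : 0 < a) (hb : 0 < b) (hx : 0 ≤ x) (hy : 0 ≤ y)
    (h : a * x + b * y = 0) : x = 0 ∧ y = 0 := by
  have h1 := mul_nonneg ha.le hx
  have h2 := mul_nonneg hb.le hy
  exact ⟨(mul_eq_zero.1 (by linarith : a * x = 0)).resolve_left ha.ne',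
    (mul_eq_zero.1 (by linarith : b * y = 0)).resolve_left hb.ne'⟩

/-- A feasible point is a vertex if it is determined by its tight bounds. -/
theorem mem_extremePoints_of_tight {z : Fin ℓ → ℝ} {u v : Fin n → ℝ} {π : ℝ}
    (hp : (u, v, π) ∈ I.polytope z)
    (h : ∀ u' v' π', (u', v', π') ∈ I.polytope z → (∀ j, u j = 0 → u' j = 0) →
      (∀ j, v j = 0 → v' j = 0) → (∀ j, u j = π → u' j = π') → (π = 0 → π' = 0) →
      u' = u ∧ v' = v ∧ π' = π) :
    (u, v, π) ∈ (I.polytope z).extremePoints ℝ := by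
  rw [mem_extremePoints]
  refine ⟨hp, ?_⟩
  rintro ⟨u₁, v₁, π₁⟩ h₁ ⟨u₂, v₂, π₂⟩ h₂ ⟨a, b, ha, hb, hab, heq⟩
  simp only [Prod.smul_mk, Prod.mk_add_mk, Prod.mk.injEq, smul_eq_mul] at heq
  obtain ⟨hu, hv, hπ⟩ := heq
  have hu' : ∀ j, a * u₁ j + b * u₂ j = u j := fun j => by simpa using congrFun hu j
  have hv' : ∀ j, a * v₁ j + b * v₂ j = v j := fun j => by simpa using congrFun hv j
  have k1 := h₁
  have k2 := h₂
  obtain ⟨-, hu1, hv1, hπ1, -⟩ := k1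
  obtain ⟨-, hu2, hv2, hπ2, -⟩ := k2
  simp only at hu1 hv1 hπ1 hu2 hv2 hπ2
  -- A bound that is tight at a proper convex combination is tight at both end points, so both
  -- satisfy the hypotheses of `h`.
  have c1 := fun j (hj : u j = 0) =>
    eq_zero_of_openSegment ha hb (hu1 j).1 (hu2 j).1 ((hu' j).trans hj)
  have c2 := fun j (hj : v j = 0) =>
    eq_zero_of_openSegment ha hb (hv1 j).1 (hv2 j).1 ((hv' j).trans hj)
  have c3 := fun j (hj : u j = π) =>
    eq_zero_of_openSegment ha hb (sub_nonneg.2 (hu1 j).2) (sub_nonneg.2 (hu2 j).2)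
      (by linarith [hu' j])
  have c4 := fun (hj : π = 0) => eq_zero_of_openSegment ha hb hπ1 hπ2 (hπ.trans hj)
  obtain ⟨rfl, rfl, rfl⟩ := h u₁ v₁ π₁ h₁ (fun j hj => (c1 j hj).1) (fun j hj => (c2 j hj).1)
    (fun j hj => (sub_eq_zero.1 (c3 j hj).1).symm) (fun hj => (c4 hj).1)
  obtain ⟨rfl, rfl, rfl⟩ := h u₂ v₂ π₂ h₂ (fun j hj => (c1 j hj).2) (fun j hj => (c2 j hj).2)
    (fun j hj => (sub_eq_zero.1 (c3 j hj).2).symm) (fun hj => (c4 hj).2)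
  exact ⟨rfl, rfl⟩

/-- The packing for `π = 1 / q` is a vertex if `π` is determined by its tight bounds. -/
theorem pack_mem_extremePoints {z : Fin ℓ → ℝ} (hz : Binary z) {q : ℕ}
    (h : ∀ u' v' π', (u', v', π') ∈ I.polytope z → (∀ j, I.packV z q j = 0 → v' j = 0) →
      (∀ j, I.packU z q j = 0 → u' j = 0) → (∀ j, I.packU z q j = 1 / (q : ℝ) → u' j = π') →
      (q = 0 → π' = 0) → π' = 1 / (q : ℝ)) :
    (I.packU z q, I.packV z q, 1 / (q : ℝ)) ∈ (I.polytope z).extremePoints ℝ := by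
  classical
  have hpk := I.pack_mem_polytope hz q
  refine mem_extremePoints_of_tight hpk fun u' v' π' hp hu hv huπ hπ => ?_
  have hπ' : π' = 1 / (q : ℝ) := h u' v' π' hp hv hu huπ fun hq => hπ (by simp [hq])
  have hu' : ∀ j, u' j = I.packU z q j := by
    intro j
    have : I.packU z q j = 0 ∨ I.packU z q j = 1 / (q : ℝ) := by
      rw [packU]
      rcases hz (I.label j) with h | h <;> rw [h] <;> split_ifs <;> simp
    rcases this with h0 | h0
    · rw [hu j h0, h0]
    · rw [huπ j h0, h0, hπ']
  have hv' : ∀ j, j ≠ I.worstTool (I.label j) → v' j = I.packV z q j := by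
    intro j hj
    have h0 : I.packV z q j = 0 := by rw [packV, if_neg hj, mul_zero]
    rw [hv j h0, h0]
  refine ⟨funext hu', funext fun j => ?_, hπ'⟩
  -- The only variable not necessarily fixed by a tight bound is `v` at `worstTool`; the equation of
  -- its tool set determines it.
  by_cases hj : j = I.worstTool (I.label j)
  · have e1 := hp.1 (I.label j)
    have e2 := hpk.1 (I.label j)
    simp only at e1 e2
    have hjT : j ∈ I.T (I.label j) := I.mem_T.2 rfl
    rw [← Finset.add_sum_erase _ _ hjT] at e1 e2
    have : ∑ i ∈ (I.T (I.label j)).erase j, (u' i + v' i)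
        = ∑ i ∈ (I.T (I.label j)).erase j, (I.packU z q i + I.packV z q i) := by
      refine Finset.sum_congr rfl fun i hi => ?_
      obtain ⟨hne, hi⟩ := Finset.mem_erase.1 hi
      rw [hu' i, hv' i]
      rw [I.mem_T.1 hi, ← hj]
      exact hne
    rw [this, hu' j] at e1
    linarith
  · exact hv' j hj

theorem pack_zero_mem_extremePoints {z : Fin ℓ → ℝ} (hz : Binary z) :
    (I.packU z 0, I.packV z 0, 1 / ((0 : ℕ) : ℝ)) ∈ (I.polytope z).extremePoints ℝ :=
  pack_mem_extremePoints hz fun _ _ _ _ _ _ _ h => by simpa using h rfl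

/-- The tool `j` is the last of exactly `q` cheap tools in an open set. They use up the whole unit,
`v` vanishes there, and the equation of the set becomes `q * π' = 1`. -/
theorem pack_mem_extremePoints_of_rank {z : Fin ℓ → ℝ} (hz : Binary z) {q : ℕ} {j : Fin n}
    (hzj : z (I.label j) = 0) (hc : I.c j ≤ I.worst (I.label j)) (hr : I.rank I.c j + 1 = q) :
    (I.packU z q, I.packV z q, 1 / (q : ℝ)) ∈ (I.polytope z).extremePoints ℝ := by
  have hq0 : (q : ℝ) ≠ 0 := by rw [← hr]; positivity
  refine pack_mem_extremePoints hz fun u' v' π' hp hv hu huπ _ => ?_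
  set l := I.label j with hl
  have hjT : j ∈ I.T l := I.mem_T.2 rfl
  have hcheap : I.cheapest q l = (I.T l).filter fun i => I.rank I.c i < q := by
    ext i
    rw [mem_cheapest, Finset.mem_filter]
    refine and_congr_right fun hi => and_iff_left_of_imp fun h => le_trans ?_ hc
    exact weight_le_of_rank_le ((I.mem_T.1 hi).trans hl) (by omega)
  have hcard : (I.cheapest q l).card = q := by
    rw [hcheap]
    refine card_rank_lt I.c ?_
    have := rank_lt_card (w := I.c) hjT
    omega
  have hv0 : ∀ i ∈ I.T l, v' i = 0 := by
    intro i hi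
    refine hv i ?_
    rw [packV, I.mem_T.1 hi, hcard, div_self hq0]
    simp
  classical
  have hu0 : ∀ i ∈ I.T l, u' i = if i ∈ I.cheapest q l then π' else 0 := by
    intro i hi
    split_ifs with h
    · refine huπ i ?_
      rw [packU, I.mem_T.1 hi, if_pos h, hzj]
      ring
    · refine hu i ?_
      rw [packU, I.mem_T.1 hi, if_neg h, mul_zero]
  have hsum := hp.1 l
  simp only [hzj, zero_add] at hsum
  have : ∑ i ∈ I.T l, (u' i + v' i) = q * π' := by
    rw [Finset.sum_congr rfl fun i hi => by rw [hv0 i hi, hu0 i hi, add_zero],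
      ← Finset.sum_filter, Finset.filter_mem_eq_inter,
      Finset.inter_eq_right.2 (cheapest_subset q l), Finset.sum_const, hcard, nsmul_eq_mul]
  rw [this] at hsum
  rw [eq_div_iff hq0, mul_comm]
  exact hsum

/-- If no open set gains a cheap tool in passing from `q - 1` to `q`, both costs have the form `A +
B / p` with the same `A` and `B`. Since `q` is no worse than `q - 1`, the slope `B` is nonnegative,
and the value `A` at `π = 0` is at most the cost at `q`. -/
theorem stageCost_zero_le {z : Fin ℓ → ℝ} (hz : Binary z) {q : ℕ} (hq : 1 ≤ q)
    (hmin : I.stageCost z q ≤ I.stageCost z (q - 1))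
    (h : ∀ j, z (I.label j) = 0 → I.c j ≤ I.worst (I.label j) → I.rank I.c j + 1 ≠ q) :
    I.stageCost z 0 ≤ I.stageCost z q := by
  have hcheap : ∀ l, z l = 0 → I.cheapest (q - 1) l = I.cheapest q l := by
    intro l hl
    ext j
    rw [mem_cheapest, mem_cheapest]
    refine and_congr_right fun hj => and_congr_left fun hc => ?_
    have := h j (by rw [I.mem_T.1 hj, hl]) (by rwa [I.mem_T.1 hj])
    omega
  set B : ℝ := I.Γ - ∑ l, (1 - z l) * I.gain q l with hB
  have e1 : ∀ p : ℕ, (∀ l, (1 - z l) * I.gain p l = (1 - z l) * I.gain q l) →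
      I.stageCost z p = ∑ l, (1 - z l) * I.worst l + B * (1 / (p : ℝ)) := by
    intro p hp
    have : ∑ l, (1 - z l) * I.unitCost p l
        = ∑ l, (1 - z l) * I.worst l - (∑ l, (1 - z l) * I.gain q l) * (1 / (p : ℝ)) := by
      rw [Finset.sum_mul, ← Finset.sum_sub_distrib]
      refine Finset.sum_congr rfl fun l _ => ?_
      rw [← hp l, unitCost]
      ring
    rw [stageCost, this, hB]
    ring
  have e0 : I.stageCost z 0 = ∑ l, (1 - z l) * I.worst l := by
    simp [stageCost, unitCost_zero]
  have hB0 : 0 ≤ B := by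
    rcases Nat.lt_or_ge 1 q with hq1 | hq1
    · have e2 := e1 (q - 1) fun l => by
        rcases hz l with h | h
        · rw [gain, gain, hcheap l h]
        · rw [h]; ring
      rw [e2, e1 q fun _ => rfl, add_le_add_iff_left] at hmin
      have hlt : 1 / (q : ℝ) < 1 / ((q - 1 : ℕ) : ℝ) := by
        refine one_div_lt_one_div_of_lt ?_ ?_
        · exact_mod_cast (by omega : 0 < q - 1)
        · exact_mod_cast (by omega : q - 1 < q)
      by_contra hneg
      exact absurd hmin (not_le.2 (mul_lt_mul_of_neg_left hlt (not_le.1 hneg)))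
    -- For `q = 1` the index `q - 1` stands for `π = 0` and gives no comparison. But an open set
    -- would contain a cheap tool of rank zero, so no set is open and `B = Γ`.
    · have hz1 : ∀ l, z l = 1 := by
        intro l
        refine (hz l).resolve_left fun hl => ?_
        obtain ⟨j, hj, hr⟩ := I.exists_rank_eq_zero I.c l
        have hjl := I.mem_T.1 hj
        exact h j (by rw [hjl, hl]) (by rw [hjl]; exact c_le_worst_of_rank_eq_zero hj hr)
          (by omega)
      simp [hB, hz1, I.Γ_nonneg]
  rw [e0, e1 q fun _ => rfl]
  have : 0 ≤ B * (1 / (q : ℝ)) := by positivity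
  linarith

theorem exists_pack_mem_extremePoints {z : Fin ℓ → ℝ} (hz : Binary z) {q : ℕ} (hqn : q ≤ n)
    (hmin : ∀ p ≤ n, I.stageCost z q ≤ I.stageCost z p) :
    ∃ p ≤ n, I.stageCost z p = I.stageCost z q ∧
      (I.packU z p, I.packV z p, 1 / (p : ℝ)) ∈ (I.polytope z).extremePoints ℝ := by
  by_cases h0 : I.stageCost z 0 ≤ I.stageCost z q
  · exact ⟨0, Nat.zero_le _, le_antisymm h0 (hmin 0 (Nat.zero_le _)),
      pack_zero_mem_extremePoints hz⟩
  · have hq : 1 ≤ q := by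
      by_contra hcon
      obtain rfl : q = 0 := by omega
      exact h0 le_rfl
    by_contra hcon
    refine h0 (stageCost_zero_le hz hq (hmin _ (by omega)) fun j hzj hc hr => hcon ?_)
    exact ⟨q, hqn, rfl, pack_mem_extremePoints_of_rank hz hzj hc hr⟩

theorem exists_optimal_vertex (I : RSInstance n ℓ) :
    ∃ (x : Fin ℓ → ℝ) (u v : Fin n → ℝ) (π : ℝ),
      I.MIPFeasible x u v π ∧
      (∀ x' u' v' π', I.MIPFeasible x' u' v' π' → I.obj x u v π ≤ I.obj x' u' v' π') ∧
      IsOptimalValue I.X I.U I.C (I.obj x u v π) ∧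
      (u, v, π) ∈ (I.polytope x).extremePoints ℝ ∧
      (π = 0 ∨ ∃ p : ℕ, 1 ≤ p ∧ p ≤ n ∧ π = 1 / (p : ℝ)) := by
  obtain ⟨q, hq, hqmin⟩ := I.exists_leastCost_le
  have hz := I.binary_bestStage q
  have hmin := totalCost_bestStage_le hqmin
  obtain ⟨p, hp, hpq, hext⟩ := exists_pack_mem_extremePoints hz hq
    fun p hp => (add_le_add_iff_left _).1 (hmin _ hz p hp)
  have hobj : I.obj (I.bestStage q) (I.packU (I.bestStage q) p) (I.packV (I.bestStage q) p)
      (1 / (p : ℝ)) = I.totalCost (I.bestStage q) q := by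
    rw [obj_eq, secondCost_pack, hpq, totalCost]
  refine ⟨I.bestStage q, _, _, 1 / (p : ℝ), ⟨hz, pack_mem_polytope hz p⟩, ?_, ?_, hext, ?_⟩
  · intro x' u' v' π' h
    obtain ⟨r, hr, hle⟩ := exists_totalCost_le_obj h
    exact hobj.trans_le ((hmin x' h.1 r hr).trans hle)
  · rw [hobj]
    exact isOptimalValue_totalCost hz hmin
  · rcases Nat.eq_zero_or_pos p with rfl | h
    · left; simp
    · exact Or.inr ⟨p, h, hp, rfl⟩

/-! ### Greedy packings -/

/-- Induction removing a most expensive item `a`: if the others can hold the amount `r`, leave `a`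
empty; otherwise fill them and put the rest into `a`. -/
theorem exists_greedy {ι : Type} [DecidableEq ι] (w κ : ι → ℝ) (hκ : ∀ i, 0 ≤ κ i) (S : Finset ι) :
    ∀ r, 0 ≤ r → r ≤ ∑ i ∈ S, κ i → ∃ f : ι → ℝ, (∀ i, 0 ≤ f i ∧ f i ≤ κ i) ∧
      ∑ i ∈ S, f i = r ∧ ∀ a ∈ S, ∀ b ∈ S, w a < w b → 0 < f b → f a = κ a := by
  induction S using Finset.induction_on_max_value w with
  | empty =>
    intro r hr hr'
    rw [Finset.sum_empty] at hr'
    exact ⟨fun _ => 0, fun i => ⟨le_rfl, hκ i⟩, by simpa using le_antisymm hr hr', by simp⟩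
  | insert a S ha hmax ih =>
    intro r hr hr'
    rw [Finset.sum_insert ha] at hr'
    rcases le_total r (∑ i ∈ S, κ i) with h | h
    · obtain ⟨f, hf, hsum, hg⟩ := ih r hr h
      refine ⟨Function.update f a 0, fun i => ?_, ?_, ?_⟩
      · rcases eq_or_ne i a with rfl | hi
        · simpa using hκ i
        · simpa [hi] using hf i
      · rw [Finset.sum_insert ha, Function.update_self, zero_add, ← hsum]
        exact Finset.sum_congr rfl fun i hi =>
          Function.update_of_ne (ne_of_mem_of_not_mem hi ha) _ _
      · intro b hb e he hlt hpos
        have hea : e ≠ a := by rintro rfl; simp at hpos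
        have heS := (Finset.mem_insert.1 he).resolve_left hea
        have hba : b ≠ a := by rintro rfl; exact absurd (hmax e heS) (not_le.2 hlt)
        rw [Function.update_of_ne hea] at hpos
        rw [Function.update_of_ne hba]
        exact hg b ((Finset.mem_insert.1 hb).resolve_left hba) e heS hlt hpos
    · refine ⟨Function.update κ a (r - ∑ i ∈ S, κ i), fun i => ?_, ?_, ?_⟩
      · rcases eq_or_ne i a with rfl | hi
        · simp only [Function.update_self]
          exact ⟨by linarith, by linarith⟩
        · rw [Function.update_of_ne hi]
          exact ⟨hκ i, le_rfl⟩
      · rw [Finset.sum_insert ha, Function.update_self,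
          Finset.sum_congr rfl fun i hi => Function.update_of_ne (ne_of_mem_of_not_mem hi ha) _ _]
        ring
      · intro b hb e he hlt _
        have hba : b ≠ a := by
          rintro rfl
          rcases Finset.mem_insert.1 he with rfl | heS
          · exact lt_irrefl _ hlt
          · exact absurd (hmax e heS) (not_le.2 hlt)
        exact Function.update_of_ne hba _ _

/-- Let `b` be a most expensive item used by `f`. Cheaper items are full and dearer ones empty, so
`(w i - w b) * (g i - f i)` is never negative; summing removes `w b`, because `f` and `g` have equal
totals. -/
theorem greedy_le {ι : Type} {w κ f g : ι → ℝ} {S : Finset ι} (hf : ∀ i ∈ S, 0 ≤ f i)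
    (hg : ∀ i ∈ S, 0 ≤ g i ∧ g i ≤ κ i) (hsum : ∑ i ∈ S, f i = ∑ i ∈ S, g i)
    (hgreedy : ∀ a ∈ S, ∀ b ∈ S, w a < w b → 0 < f b → f a = κ a) :
    ∑ i ∈ S, w i * f i ≤ ∑ i ∈ S, w i * g i := by
  by_cases hpos : ∃ b ∈ S, 0 < f b
  · obtain ⟨b₀, hb₀, hb₀'⟩ := hpos
    obtain ⟨b, hb, hmax⟩ := Finset.exists_max_image (S.filter fun i => 0 < f i) w
      ⟨b₀, Finset.mem_filter.2 ⟨hb₀, hb₀'⟩⟩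
    obtain ⟨hbS, hb⟩ := Finset.mem_filter.1 hb
    have key : ∀ i ∈ S, w b * (g i - f i) ≤ w i * (g i - f i) := by
      intro i hi
      rcases lt_trichotomy (w i) (w b) with h | h | h
      · have := hgreedy i hi b hbS h hb
        nlinarith [(hg i hi).2]
      · rw [h]
      · have : f i = 0 := by
          by_contra hne
          have := hmax i (Finset.mem_filter.2 ⟨hi, (hf i hi).lt_of_ne' hne⟩)
          linarith
        rw [this, sub_zero]
        exact mul_le_mul_of_nonneg_right h.le (hg i hi).1
    have := Finset.sum_le_sum key
    rw [← Finset.mul_sum, Finset.sum_sub_distrib, hsum, sub_self, mul_zero] at this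
    simp only [mul_sub, Finset.sum_sub_distrib] at this
    linarith
  · push Not at hpos
    have hf0 : ∀ i ∈ S, f i = 0 := fun i hi => le_antisymm (hpos i hi) (hf i hi)
    rw [Finset.sum_eq_zero hf0] at hsum
    have hg0 := (Finset.sum_eq_zero_iff_of_nonneg fun i hi => (hg i hi).1).1 hsum.symm
    exact Finset.sum_le_sum fun i hi => by rw [hf0 i hi, hg0 i hi]

theorem sum_disjSum_T {M : Type} [AddCommMonoid M] (f : Fin n ⊕ Fin n → M) (l : Fin ℓ) :
    ∑ a ∈ (I.T l).disjSum (I.T l), f a = ∑ j ∈ I.T l, (f (Sum.inl j) + f (Sum.inr j)) := by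
  rw [Finset.sum_disjSum, Finset.sum_add_distrib]

theorem mem_disjSum_T {a : Fin n ⊕ Fin n} {l : Fin ℓ} :
    a ∈ (I.T l).disjSum (I.T l) ↔ Sum.elim I.label I.label a = l := by
  cases a <;> simp [mem_T]

theorem exists_isGreedyPacking (I : RSInstance n ℓ) {π : ℝ} (h0 : 0 ≤ π) (h1 : π ≤ 1) :
    ∃ u v : Fin n → ℝ, I.IsGreedyPacking π u v := by
  classical
  set κ : Fin n ⊕ Fin n → ℝ := Sum.elim (fun _ => π) (fun _ => 1 - π) with hκ
  have hκ0 : ∀ a, 0 ≤ κ a := by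
    rintro (j | j) <;> simp [hκ, h0, h1]
  -- Each tool has total capacity `π + (1 - π) = 1`, and no tool set is empty.
  have hcap : ∀ l, 1 ≤ ∑ a ∈ (I.T l).disjSum (I.T l), κ a := by
    intro l
    rw [sum_disjSum_T]
    simp only [hκ, Sum.elim_inl, Sum.elim_inr, add_sub_cancel, Finset.sum_const, nsmul_eq_mul,
      mul_one]
    exact_mod_cast Finset.card_pos.2 (I.T_nonempty l)
  choose f hf hsum hgr using fun l => exists_greedy (Sum.elim I.c (I.c + I.d)) κ hκ0
    ((I.T l).disjSum (I.T l)) 1 zero_le_one (hcap l)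
  refine ⟨fun j => f (I.label j) (Sum.inl j), fun j => f (I.label j) (Sum.inr j), ?_, ?_, ?_, ?_⟩
  · intro l
    have := hsum l
    rw [sum_disjSum_T] at this
    rw [← this]
    exact Finset.sum_congr rfl fun j hj => by simp only [I.mem_T.1 hj]
  · exact fun j => hf _ (Sum.inl j)
  · exact fun j => hf _ (Sum.inr j)
  · intro a b hab hw hb
    have e : ∀ a, Sum.elim (fun j => f (I.label j) (Sum.inl j)) (fun j => f (I.label j) (Sum.inr j))
        a = f (Sum.elim I.label I.label a) a := by
      rintro (j | j) <;> rfl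
    rw [e] at hb ⊢
    rw [hab]
    exact hgr _ a (mem_disjSum_T.2 hab) b (mem_disjSum_T.2 rfl) hw hb

theorem packCost_le_of_greedy {π : ℝ} {u v : Fin n → ℝ} (h : I.IsGreedyPacking π u v)
    {u' v' : Fin n → ℝ} {l : Fin ℓ} (hu : ∀ j, 0 ≤ u' j ∧ u' j ≤ π)
    (hv : ∀ j, 0 ≤ v' j ∧ v' j ≤ 1 - π) (hsum : ∑ j ∈ I.T l, (u' j + v' j) = 1) :
    I.packCost u v l ≤ I.packCost u' v' l := by
  obtain ⟨h1, h2, h3, h4⟩ := h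
  have := greedy_le (w := Sum.elim I.c (I.c + I.d))
    (κ := Sum.elim (fun _ => π) (fun _ => 1 - π)) (f := Sum.elim u v) (g := Sum.elim u' v')
    (S := (I.T l).disjSum (I.T l)) ?_ ?_ ?_ ?_
  · rwa [sum_disjSum_T, sum_disjSum_T] at this
  · rintro (j | j) -
    · exact (h2 j).1
    · exact (h3 j).1
  · rintro (j | j) -
    · exact hu j
    · exact hv j
  · rw [sum_disjSum_T, sum_disjSum_T]
    exact (h1 l).trans hsum.symm
  · intro a ha b hb
    exact h4 a b ((mem_disjSum_T.1 ha).trans (mem_disjSum_T.1 hb).symm)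

theorem binary_firstStage (u v : Fin n → ℝ) : Binary (I.firstStage u v) := by
  intro l
  unfold firstStage
  split_ifs <;> simp

/-- With `π` fixed, the term `Γ * π` is constant and the tool sets decouple. Each contributes at
least the minimum of `Chat` and the greedy cost, which the rule attains. -/
theorem firstStage_optimal {π : ℝ} (h0 : 0 ≤ π) (h1 : π ≤ 1) {u v : Fin n → ℝ}
    (h : I.IsGreedyPacking π u v) :
    I.MIPFeasible (I.firstStage u v) (I.keep u v u) (I.keep u v v) π ∧
    ∀ x' u' v', I.MIPFeasible x' u' v' π →
      I.obj (I.firstStage u v) (I.keep u v u) (I.keep u v v) π ≤ I.obj x' u' v' π := by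
  have hb := I.binary_firstStage u v
  have hz0 : ∀ l, 0 ≤ 1 - I.firstStage u v l ∧ 1 - I.firstStage u v l ≤ 1 := by
    intro l; rcases hb l with h | h <;> rw [h] <;> norm_num
  have hscale : ∀ (l : Fin ℓ) (a b : ℝ), 0 ≤ a ∧ a ≤ b →
      0 ≤ (1 - I.firstStage u v l) * a ∧ (1 - I.firstStage u v l) * a ≤ b := by
    rintro l a b ⟨ha, hab⟩
    exact ⟨mul_nonneg (hz0 l).1 ha,
      (mul_le_mul_of_nonneg_right (hz0 l).2 ha).trans ((one_mul a).trans_le hab)⟩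
  refine ⟨⟨hb, fun l => ?_, fun j => hscale _ _ _ (h.2.1 j), fun j => hscale _ _ _ (h.2.2.1 j),
    h0, h1⟩, ?_⟩
  · have : ∑ j ∈ I.T l, (I.keep u v u j + I.keep u v v j)
        = (1 - I.firstStage u v l) * ∑ j ∈ I.T l, (u j + v j) := by
      rw [Finset.mul_sum]
      refine Finset.sum_congr rfl fun j hj => ?_
      rw [keep, keep, I.mem_T.1 hj]
      ring
    simp only [this, h.1 l]
    ring
  · intro x' u' v' hfeas
    obtain ⟨hx', hp1, hp2, hp3, -⟩ := hfeas
    simp only at hp1 hp2 hp3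
    rw [obj_eq, obj_eq, secondCost_eq, secondCost_eq]
    have key : ∑ l, (I.Chat l * I.firstStage u v l
          + I.packCost (I.keep u v u) (I.keep u v v) l)
        ≤ ∑ l, (I.Chat l * x' l + I.packCost u' v' l) := by
      refine Finset.sum_le_sum fun l _ => ?_
      have e1 : I.packCost (I.keep u v u) (I.keep u v v) l
          = (1 - I.firstStage u v l) * I.packCost u v l := by
        rw [packCost, packCost, Finset.mul_sum]
        refine Finset.sum_congr rfl fun j hj => ?_
        rw [keep, keep, I.mem_T.1 hj]
        ring
      have e2 : I.Chat l * I.firstStage u v l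
          + I.packCost (I.keep u v u) (I.keep u v v) l = min (I.Chat l) (I.packCost u v l) := by
        rw [e1]
        unfold firstStage
        split_ifs with hc
        · rw [min_eq_left hc]; ring
        · rw [min_eq_right (not_le.1 hc).le]; ring
      rw [e2]
      rcases hx' l with hl | hl
      · rw [hl, mul_zero, zero_add]
        refine (min_le_right _ _).trans (packCost_le_of_greedy h hp2 hp3 ?_)
        rw [← hp1 l, hl, zero_add]
      · rw [hl, mul_one]
        have : 0 ≤ I.packCost u' v' l := Finset.sum_nonneg fun j _ =>
          add_nonneg (mul_nonneg (I.c_nonneg j) (hp2 j).1)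
            (mul_nonneg (add_nonneg (I.c_nonneg j) (I.d_nonneg j)) (hp3 j).1)
        exact (min_le_left _ _).trans (by linarith)
    rw [Finset.sum_add_distrib, Finset.sum_add_distrib] at key
    linarith

end RSInstance

end RTSt

namespace RTSt

/-! ### Reasoning about programs -/

namespace Store

theorem setNat_nat (s : Store) (a i v b j : ℕ) :
    (s.setNat a i v).nat b j = if b = a ∧ j = i then v else s.nat b j := by
  by_cases hb : b = a
  · subst hb
    by_cases hj : j = i <;> simp [setNat, hj]
  · simp [setNat, hb]

theorem setNat_real (s : Store) (a i v : ℕ) : (s.setNat a i v).real = s.real := rfl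

theorem setReal_nat (s : Store) (a i : ℕ) (v : ℝ) : (s.setReal a i v).nat = s.nat := rfl

theorem setReal_real (s : Store) (a i : ℕ) (v : ℝ) (b j : ℕ) :
    (s.setReal a i v).real b j = if b = a ∧ j = i then v else s.real b j := by
  by_cases hb : b = a
  · subst hb
    by_cases hj : j = i <;> simp [setReal, hj]
  · simp [setReal, hb]

/-- The stores `s` and `s'` agree outside the arrays in `N` and `R`. -/
def Frame (N R : Finset ℕ) (s s' : Store) : Prop :=
  (∀ a ∉ N, s'.nat a = s.nat a) ∧ ∀ a ∉ R, s'.real a = s.real a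

variable {N R N' R' : Finset ℕ} {s s' s'' : Store}

theorem Frame.refl (N R : Finset ℕ) (s : Store) : Frame N R s s := ⟨fun _ _ => rfl, fun _ _ => rfl⟩

theorem Frame.trans (h : Frame N R s s') (h' : Frame N R s' s'') : Frame N R s s'' :=
  ⟨fun a ha => (h'.1 a ha).trans (h.1 a ha), fun a ha => (h'.2 a ha).trans (h.2 a ha)⟩

theorem Frame.mono (h : Frame N R s s') (hN : N ⊆ N') (hR : R ⊆ R') : Frame N' R' s s' :=
  ⟨fun a ha => h.1 a fun h => ha (hN h), fun a ha => h.2 a fun h => ha (hR h)⟩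

theorem Frame.setNat (h : Frame N R s s') {a : ℕ} (ha : a ∈ N) (i v : ℕ) :
    Frame N R s (s'.setNat a i v) := by
  refine ⟨fun b hb => ?_, h.2⟩
  rw [← h.1 b hb]
  exact Function.update_of_ne (ne_of_mem_of_not_mem ha hb).symm _ _

theorem Frame.setReal (h : Frame N R s s') {a : ℕ} (ha : a ∈ R) (i : ℕ) (v : ℝ) :
    Frame N R s (s'.setReal a i v) := by
  refine ⟨h.1, fun b hb => ?_⟩
  rw [← h.2 b hb]
  exact Function.update_of_ne (ne_of_mem_of_not_mem ha hb).symm _ _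

end Store

open Store

/-- Started in `s`, the program `P` stops after at most `T` steps in a memory that satisfies `Q`. -/
def Runs (P : Program) (s : Store) (T : ℕ) (Q : Store → Prop) : Prop :=
  ∃ s' t, Exec P s s' t ∧ t ≤ T ∧ Q s'

section Runs

variable {P P' : Program} {s : Store} {T T' : ℕ} {Q Q' : Store → Prop}

theorem Runs.mono (h : Runs P s T Q) (hQ : ∀ s', Q s' → Q' s') : Runs P s T Q' := by
  obtain ⟨s', t, h1, h2, h3⟩ := h
  exact ⟨s', t, h1, h2, hQ _ h3⟩

theorem Runs.seq (h : Runs P s T Q) (h' : ∀ s', Q s' → Runs P' s' T' Q') :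
    Runs (P.seq P') s (T + T') Q' := by
  obtain ⟨s', t, h1, h2, h3⟩ := h
  obtain ⟨s'', t', h1', h2', h3'⟩ := h' s' h3
  exact ⟨s'', t + t', h1.seq h1', Nat.add_le_add h2 h2', h3'⟩

namespace Program

/-- Programs without loops. -/
def LoopFree : Program → Prop
  | skip => True
  | setNat _ _ _ => True
  | setReal _ _ _ => True
  | seq P Q => P.LoopFree ∧ Q.LoopFree
  | ite _ P Q => P.LoopFree ∧ Q.LoopFree
  | loop _ _ => False

open Classical in
/-- The effect of a program without loops. -/
noncomputable def run : Program → Store → Store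
  | skip, s => s
  | setNat a i e, s => s.setNat a (i.eval s) (e.eval s)
  | setReal a i e, s => s.setReal a (i.eval s) (e.eval s)
  | seq P Q, s => Q.run (P.run s)
  | ite b P Q, s => if b.Holds s then P.run s else Q.run s
  | loop _ _, s => s

/-- An upper bound on the number of steps of a program without loops. -/
def flatCost : Program → ℕ
  | skip => 1
  | setNat _ i e => i.cost + e.cost + 1
  | setReal _ i e => i.cost + e.cost + 1
  | seq P Q => P.flatCost + Q.flatCost
  | ite b P Q => b.cost + 1 + (P.flatCost + Q.flatCost)
  | loop _ _ => 0

theorem exec_run (P : Program) (hP : P.LoopFree) (s : Store) :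
    ∃ t, Exec P s (P.run s) t ∧ t ≤ P.flatCost := by
  induction P generalizing s with
  | skip => exact ⟨_, Exec.skip s, le_rfl⟩
  | setNat a i e => exact ⟨_, Exec.setNat a i e s, le_rfl⟩
  | setReal a i e => exact ⟨_, Exec.setReal a i e s, le_rfl⟩
  | seq P Q ihP ihQ =>
    obtain ⟨t, h1, h2⟩ := ihP hP.1 s
    obtain ⟨t', h1', h2'⟩ := ihQ hP.2 (P.run s)
    exact ⟨_, h1.seq h1', Nat.add_le_add h2 h2'⟩
  | ite b P Q ihP ihQ =>
    by_cases hb : b.Holds s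
    · obtain ⟨t, h1, h2⟩ := ihP hP.1 s
      refine ⟨b.cost + 1 + t, ?_, ?_⟩
      · rw [run, if_pos hb]; exact Exec.ite_true hb h1
      · rw [flatCost]; omega
    · obtain ⟨t, h1, h2⟩ := ihQ hP.2 s
      refine ⟨b.cost + 1 + t, ?_, ?_⟩
      · rw [run, if_neg hb]; exact Exec.ite_false hb h1
      · rw [flatCost]; omega
  | loop b P _ => exact hP.elim

end Program

theorem Runs.of_loopFree (hP : P.LoopFree) (h : Q (P.run s)) : Runs P s P.flatCost Q := by
  obtain ⟨t, h1, h2⟩ := P.exec_run hP s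
  exact ⟨_, t, h1, h2, h⟩

/-- `for v = 0, …, e - 1 do P`, where the counter is cell 0 of the array `v`. -/
def forLoop (v : ℕ) (e : NExp) (P : Program) : Program :=
  .seq (.setNat v (.const 0) (.const 0))
    (.loop (.not (.natLe e (.get v (.const 0))))
      (.seq P (.setNat v (.const 0) (.add (.get v (.const 0)) (.const 1)))))

/-- An upper bound on the number of steps of a loop with `m` rounds of `T` steps. -/
def forCost (m T c : ℕ) : ℕ := m * (T + c + 11) + c + 8

/-- Induction on the number `r` of remaining rounds. A round costs `e.cost + 5` for the guard and 6
for the increment besides its body; the failing guard at the end costs `e.cost + 5`. -/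
theorem runs_while {v : ℕ} {e : NExp} {m : ℕ} {Inv : ℕ → Store → Prop}
    (hm : ∀ k s, Inv k s → e.eval s = m) (hv : ∀ k s, Inv k s → s.nat v 0 = k)
    (hstep : ∀ k s, k < m → Inv k s →
      Runs P s T fun s' => Inv (k + 1) (s'.setNat v 0 (s'.nat v 0 + 1)))
    (r k : ℕ) (hk : k + r = m) (s : Store) (hs : Inv k s) :
    Runs (.loop (.not (.natLe e (.get v (.const 0))))
      (.seq P (.setNat v (.const 0) (.add (.get v (.const 0)) (.const 1))))) s
      (r * (T + e.cost + 11) + e.cost + 5) (Inv m) := by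
  induction r generalizing k s with
  | zero =>
    refine ⟨s, _, Exec.loop_false ?_, ?_, ?_⟩
    · have := hm k s hs
      have := hv k s hs
      simp only [BExp.Holds, NExp.eval, not_not]
      omega
    · simp only [BExp.cost, NExp.cost]; omega
    · obtain rfl : k = m := by omega
      exact hs
  | succ r ih =>
    obtain ⟨s', t, h1, h2, h3⟩ := hstep k s (by omega) hs
    obtain ⟨s'', t', h1', h2', h3'⟩ := ih (k + 1) (by omega) _ h3
    refine ⟨s'', _, Exec.loop_true ?_ (h1.seq (Exec.setNat _ _ _ s')) h1', ?_, h3'⟩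
    · have := hm k s hs
      have := hv k s hs
      simp only [BExp.Holds, NExp.eval]
      omega
    · simp only [BExp.cost, NExp.cost]
      have : (r + 1) * (T + e.cost + 11) = r * (T + e.cost + 11) + (T + e.cost + 11) := by ring
      omega

/-- The rule for loops: `J` is an invariant, and only the arrays in `N` and `R` are changed. -/
theorem Runs.forLoop {v : ℕ} {e : NExp} {m : ℕ} {J : ℕ → Store → Prop} {N R : Finset ℕ}
    (hvN : v ∈ N) (hm : ∀ s', Frame N R s s' → e.eval s' = m)
    (hJ : ∀ k s' x, J k s' → J k (s'.setNat v 0 x)) (h0 : J 0 s)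
    (hstep : ∀ k s', k < m → Frame N R s s' → s'.nat v 0 = k → J k s' →
      Runs P s' T fun s'' => Frame N R s s'' ∧ s''.nat v 0 = k ∧ J (k + 1) s'') :
    Runs (forLoop v e P) s (forCost m T e.cost) fun s' => Frame N R s s' ∧ J m s' := by
  have hset : ∀ (s' : Store) (x : ℕ), (s'.setNat v 0 x).nat v 0 = x := fun s' x => by
    simp [setNat_nat]
  have hw := runs_while (P := P) (T := T) (v := v) (e := e) (m := m)
    (Inv := fun k s' => Frame N R s s' ∧ s'.nat v 0 = k ∧ J k s')
    (fun k s' h => hm s' h.1) (fun k s' h => h.2.1)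
    (fun k s' hk h => (hstep k s' hk h.1 h.2.1 h.2.2).mono fun s'' h => ⟨h.1.setNat hvN _ _, by
      rw [hset, h.2.1], hJ _ _ _ h.2.2⟩)
    m 0 (Nat.zero_add m) (s.setNat v 0 0)
    ⟨(Frame.refl N R s).setNat hvN _ _, hset _ _, hJ _ _ _ h0⟩
  obtain ⟨s', t, h1, h2, h3⟩ := hw
  refine ⟨s', _, Exec.seq (Exec.setNat v (.const 0) (.const 0) s) h1, ?_, h3.1, h3.2.2⟩
  simp only [NExp.cost, forCost]
  omega

end Runs

/-! ### Partial sums -/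

/-- The sum of the first `k` entries of a vector. -/
def partialSum {M : Type} [AddCommMonoid M] {n : ℕ} (f : Fin n → M) (k : ℕ) : M :=
  ∑ j : Fin n, if (j : ℕ) < k then f j else 0

section partialSum

variable {M : Type} [AddCommMonoid M] {n : ℕ} (f : Fin n → M)

theorem partialSum_zero : partialSum f 0 = 0 := by simp [partialSum]

theorem partialSum_succ (j : Fin n) : partialSum f (j + 1) = partialSum f j + f j := by
  have : f j = ∑ i : Fin n, if i = j then f i else 0 := by simp
  rw [partialSum, partialSum, this, ← Finset.sum_add_distrib]
  refine Finset.sum_congr rfl fun i _ => ?_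
  rcases lt_trichotomy i j with h | rfl | h
  · have h' : (i : ℕ) < j := h
    simp [h.ne, h', h'.trans (Nat.lt_succ_self _)]
  · simp
  · have h' : (j : ℕ) < i := h
    simp [h.ne', not_lt.2 h'.le, not_le.2 h]

theorem partialSum_all : partialSum f n = ∑ j, f j := by simp [partialSum]

end partialSum

end RTSt

namespace RTSt

open Store

namespace RSInstance

variable {n ℓ : ℕ} (I : RSInstance n ℓ)

/-! ### Tables: ranks and worst-case costs -/

/-- The memory `s` contains the input. -/
structure Loaded (s : Store) : Prop where
  size : s.nat 0 0 = n
  label : ∀ j : Fin n, s.nat 1 j = I.label j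
  budget : s.real 0 0 = I.Γ
  first : ∀ j : Fin n, s.real 1 j = I.C j
  nominal : ∀ j : Fin n, s.real 2 j = I.c j
  deviation : ∀ j : Fin n, s.real 3 j = I.d j

variable {I}

theorem Loaded.of_frame {N R : Finset ℕ} {s s' : Store} (h : I.Loaded s) (hf : Frame N R s s')
    (hN : ∀ a ∈ N, 2 ≤ a) (hR : ∀ a ∈ R, 4 ≤ a) : I.Loaded s' := by
  have hn : ∀ a < 2, s'.nat a = s.nat a := fun a ha => hf.1 a fun h => by have := hN a h; omega
  have hr : ∀ a < 4, s'.real a = s.real a := fun a ha => hf.2 a fun h => by have := hR a h; omega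
  constructor
  · rw [hn 0 (by norm_num)]; exact h.size
  · rw [hn 1 (by norm_num)]; exact h.label
  · rw [hr 0 (by norm_num)]; exact h.budget
  · rw [hr 1 (by norm_num)]; exact h.first
  · rw [hr 2 (by norm_num)]; exact h.nominal
  · rw [hr 3 (by norm_num)]; exact h.deviation

theorem loaded_encode (I : RSInstance n ℓ) : I.Loaded I.encode := by
  constructor <;> simp [encode, toArray]

end RSInstance

/-- The number of tools. -/
def toolCount : NExp := .get 0 (.const 0)

/-- The counter of outer loops. -/
def outer : NExp := .get 2 (.const 0)

/-- The counter of inner loops. -/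
def inner : NExp := .get 3 (.const 0)

/-- The two counters point to tools of the same tool set. -/
def sameSet : BExp :=
  .and (.natLe (.get 1 inner) (.get 1 outer)) (.natLe (.get 1 outer) (.get 1 inner))

/-- The inner tool precedes the outer one with respect to the real array `a`. -/
def precedesTest (a : ℕ) : BExp :=
  .and (.realLe (.get a inner) (.get a outer))
    (.not (.and (.realLe (.get a outer) (.get a inner)) (.natLe outer inner)))

def rankStep (a b : ℕ) : Program :=
  .ite (.and sameSet (precedesTest a)) (.setNat b outer (.add (.get b outer) (.const 1))) .skip

/-- Writes the ranks with respect to the real array `a` into the array `b`. -/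
def rankProgram (a b : ℕ) : Program :=
  forLoop 2 toolCount (.seq (.setNat b outer (.const 0)) (forLoop 3 toolCount (rankStep a b)))

def worstInner : RExp := .add (.get 2 inner) (.get 3 inner)

def worstStep : Program :=
  .ite (.and sameSet (.realLe worstInner (.get 6 outer))) (.setReal 6 outer worstInner) .skip

/-- Writes the smallest worst-case cost of the tool set of each tool into the real array 6. -/
def worstProgram : Program :=
  forLoop 2 toolCount (.seq (.setReal 6 outer (.add (.get 2 outer) (.get 3 outer)))
    (forLoop 3 toolCount worstStep))

namespace RSInstance

variable {n ℓ : ℕ} {I : RSInstance n ℓ}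

theorem rank_eq_partialSum (w : Fin n → ℝ) (j : Fin n) [DecidablePred fun i =>
    I.label i = I.label j ∧ Precedes w i j] :
    I.rank w j = partialSum (fun i => if I.label i = I.label j ∧ Precedes w i j then 1 else 0) n := by
  classical
  rw [partialSum_all, rank, T, Finset.filter_filter, Finset.card_filter]
  exact Finset.sum_congr rfl fun i _ => by congr

theorem holds_sameSet {s : Store} (h : I.Loaded s) {i j : Fin n} (hi : s.nat 3 0 = i)
    (hj : s.nat 2 0 = j) : sameSet.Holds s ↔ I.label i = I.label j := by
  simp only [sameSet, BExp.Holds, NExp.eval, inner, outer, hi, hj, h.label]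
  rw [← le_antisymm_iff, Fin.ext_iff]

theorem holds_precedesTest {s : Store} {a : ℕ} {w : Fin n → ℝ} (hw : ∀ j : Fin n, s.real a j = w j)
    {i j : Fin n} (hi : s.nat 3 0 = i) (hj : s.nat 2 0 = j) :
    (precedesTest a).Holds s ↔ Precedes w i j := by
  simp only [precedesTest, BExp.Holds, NExp.eval, RExp.eval, inner, outer, hi, hj, hw, Precedes,
    Fin.le_def]

/-- No sorting is needed: predecessors are counted by comparing all pairs, with the partial count as
invariant of the inner loop. The bound `4 ≤ b` keeps the table apart from the input and the two
counters. -/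
theorem runs_rankProgram {s : Store} (h : I.Loaded s) {a b : ℕ} (hb : 4 ≤ b) {w : Fin n → ℝ}
    (hw : ∀ j : Fin n, s.real a j = w j) :
    Runs (rankProgram a b) s
      (forCost n (5 + forCost n (rankStep a b).flatCost 2) 2)
      fun s' => Frame {2, 3, b} ∅ s s' ∧ ∀ j : Fin n, s'.nat b j = I.rank w j := by
  classical
  have hN : ∀ x ∈ ({2, 3, b} : Finset ℕ), 2 ≤ x := by simp; omega
  have hN' : ∀ x ∈ ({3, b} : Finset ℕ), 2 ≤ x := by simp; omega
  have hR : ∀ x ∈ (∅ : Finset ℕ), 4 ≤ x := by simp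
  have h2b : 2 ≠ b := by omega
  have h3b : 3 ≠ b := by omega
  refine (Runs.forLoop (v := 2) (e := toolCount) (m := n) (N := {2, 3, b}) (R := ∅)
    (J := fun k s' => ∀ j : Fin n, (j : ℕ) < k → s'.nat b j = I.rank w j) (by simp)
    (fun s' hf => (h.of_frame hf hN hR).size) ?_ (by simp) ?_).mono
    fun s' hs' => ⟨hs'.1, fun j => hs'.2 j j.2⟩
  · intro k s' x hJ j hj
    simpa [setNat_nat, h2b.symm] using hJ j hj
  · intro k s₁ hk hf₁ hc₁ hJ₁
    obtain ⟨j, rfl⟩ : ∃ j : Fin n, (j : ℕ) = k := ⟨⟨k, hk⟩, rfl⟩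
    have hl₁ := h.of_frame hf₁ hN hR
    refine Runs.seq (Q := fun s' => s' = s₁.setNat b j 0) ⟨_, _, Exec.setNat _ _ _ _, ?_, ?_⟩ ?_
    · simp [NExp.cost, outer]
    · simp [NExp.eval, outer, hc₁]
    rintro _ rfl
    have hf₂ : Frame {2, 3, b} ∅ s (s₁.setNat b j 0) := hf₁.setNat (by simp) _ _
    have hl₂ := h.of_frame hf₂ hN hR
    refine (Runs.forLoop (v := 3) (e := toolCount) (m := n) (N := {3, b}) (R := ∅)
      (J := fun k' s' => s'.nat b j
          = partialSum (fun i => if I.label i = I.label j ∧ Precedes w i j then 1 else 0) k' ∧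
        ∀ i : ℕ, i ≠ j → s'.nat b i = s₁.nat b i) (by simp)
      (fun s' hf => (hl₂.of_frame hf hN' hR).size) ?_ ?_ ?_).mono ?_
    · intro k s' x hJ
      simpa [setNat_nat, h3b.symm] using hJ
    · refine ⟨by simp [setNat_nat, partialSum_zero], fun i hi => by simp [setNat_nat, hi]⟩
    · intro k' s₃ hk' hf₃ hc₃ hJ₃
      obtain ⟨i, rfl⟩ : ∃ i : Fin n, (i : ℕ) = k' := ⟨⟨k', hk'⟩, rfl⟩
      have hl₃ := hl₂.of_frame hf₃ hN' hR
      have hj₃ : s₃.nat 2 0 = j := by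
        rw [hf₃.1 2 (by simp [h2b])]; simp [setNat_nat, h2b, hc₁]
      have hw₃ : ∀ j : Fin n, s₃.real a j = w j := by
        rw [hf₃.2 a (by simp), setNat_real, hf₁.2 a (by simp)]; exact hw
      refine Runs.of_loopFree ⟨trivial, trivial⟩ ?_
      have htest : (BExp.and sameSet (precedesTest a)).Holds s₃ ↔
          I.label i = I.label j ∧ Precedes w i j :=
        and_congr (holds_sameSet hl₃ hc₃ hj₃) (holds_precedesTest hw₃ hc₃ hj₃)
      rw [rankStep, Program.run, if_congr htest rfl rfl, partialSum_succ]
      split_ifs with hcond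
      · simp only [Program.run, NExp.eval, outer, hj₃, hJ₃.1]
        refine ⟨hf₃.setNat (by simp) _ _, by simp [setNat_nat, h3b, hc₃], by simp [setNat_nat],
          fun i hi => by simp [setNat_nat, hi, hJ₃.2 i hi]⟩
      · exact ⟨hf₃, hc₃, hJ₃.1, hJ₃.2⟩
    · intro s' ⟨hf', hJ', hJ''⟩
      refine ⟨hf₂.trans (hf'.mono (by simp) (by simp)), ?_, ?_⟩
      · rw [hf'.1 2 (by simp [h2b])]; simp [setNat_nat, h2b, hc₁]
      · intro i hi
        rcases eq_or_ne i j with rfl | hne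
        · rw [hJ', rank_eq_partialSum]
        · have hne' : (i : ℕ) ≠ j := fun h => hne (Fin.ext h)
          rw [hJ'' i hne']
          exact hJ₁ i (by omega)

theorem runs_worstProgram {s : Store} (h : I.Loaded s) :
    Runs worstProgram s (forCost n (10 + forCost n worstStep.flatCost 2) 2)
      fun s' => Frame {2, 3} {6} s s' ∧ ∀ j : Fin n, s'.real 6 j = I.worst (I.label j) := by
  classical
  have hN : ∀ x ∈ ({2, 3} : Finset ℕ), 2 ≤ x := by simp
  have hN' : ∀ x ∈ ({3} : Finset ℕ), 2 ≤ x := by simp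
  have hR : ∀ x ∈ ({6} : Finset ℕ), 4 ≤ x := by simp
  refine (Runs.forLoop (v := 2) (e := toolCount) (m := n) (N := {2, 3}) (R := {6})
    (J := fun k s' => ∀ j : Fin n, (j : ℕ) < k → s'.real 6 j = I.worst (I.label j)) (by simp)
    (fun s' hf => (h.of_frame hf hN hR).size) (fun k s' x hJ => hJ) (by simp) ?_).mono
    fun s' hs' => ⟨hs'.1, fun j => hs'.2 j j.2⟩
  intro k s₁ hk hf₁ hc₁ hJ₁
  obtain ⟨j, rfl⟩ : ∃ j : Fin n, (j : ℕ) = k := ⟨⟨k, hk⟩, rfl⟩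
  have hl₁ := h.of_frame hf₁ hN hR
  refine Runs.seq (Q := fun s' => s' = s₁.setReal 6 j (I.c j + I.d j))
    ⟨_, _, Exec.setReal _ _ _ _, ?_, ?_⟩ ?_
  · simp [NExp.cost, RExp.cost, outer]
  · simp [NExp.eval, RExp.eval, outer, hc₁, hl₁.nominal, hl₁.deviation]
  rintro _ rfl
  have hf₂ : Frame {2, 3} {6} s (s₁.setReal 6 j (I.c j + I.d j)) := hf₁.setReal (by simp) _ _
  have hl₂ := h.of_frame hf₂ hN hR
  refine (Runs.forLoop (v := 3) (e := toolCount) (m := n) (N := {3}) (R := {6})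
    -- The current value is a lower bound for the tools seen so far and is the cost of some tool of
    -- the set. At the end these two facts characterize the minimum.
    (J := fun k' s' =>
      (∀ i : Fin n, (i : ℕ) < k' → I.label i = I.label j → s'.real 6 j ≤ I.c i + I.d i) ∧
      (∃ i : Fin n, I.label i = I.label j ∧ s'.real 6 j = I.c i + I.d i) ∧
      ∀ i : ℕ, i ≠ j → s'.real 6 i = s₁.real 6 i) (by simp)
    (fun s' hf => (hl₂.of_frame hf hN' hR).size) (fun k s' x hJ => hJ) ?_ ?_).mono ?_
  · exact ⟨by simp, ⟨j, rfl, by simp [setReal_real]⟩, fun i hi => by simp [setReal_real, hi]⟩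
  · intro k' s₃ hk' hf₃ hc₃ ⟨hJ₃, hJ₃', hJ₃''⟩
    obtain ⟨i, rfl⟩ : ∃ i : Fin n, (i : ℕ) = k' := ⟨⟨k', hk'⟩, rfl⟩
    have hl₃ := hl₂.of_frame hf₃ hN' hR
    have hj₃ : s₃.nat 2 0 = j := by
      rw [hf₃.1 2 (by simp)]; exact hc₁
    refine Runs.of_loopFree ⟨trivial, trivial⟩ ?_
    have hval : worstInner.eval s₃ = I.c i + I.d i := by
      simp [worstInner, RExp.eval, NExp.eval, inner, hc₃, hl₃.nominal, hl₃.deviation]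
    have htest : (BExp.and sameSet (.realLe worstInner (.get 6 outer))).Holds s₃ ↔
        I.label i = I.label j ∧ I.c i + I.d i ≤ s₃.real 6 j := by
      refine and_congr (holds_sameSet hl₃ hc₃ hj₃) ?_
      rw [BExp.Holds, hval]
      simp [RExp.eval, NExp.eval, outer, hj₃]
    rw [worstStep, Program.run, if_congr htest rfl rfl]
    split_ifs with hcond
    · simp only [Program.run, hval]
      simp only [NExp.eval, outer, hj₃]
      refine ⟨hf₃.setReal (by simp) _ _, hc₃, ?_, ⟨i, hcond.1, by simp [setReal_real]⟩,
        fun i hi => by simp [setReal_real, hi, hJ₃'' i hi]⟩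
      intro i' hi' hlab
      simp only [setReal_real, and_self, if_true]
      rcases Nat.lt_succ_iff_lt_or_eq.1 hi' with h1 | h1
      · exact hcond.2.trans (hJ₃ i' h1 hlab)
      · rw [Fin.ext h1]
    · refine ⟨hf₃, hc₃, ?_, hJ₃', hJ₃''⟩
      intro i' hi' hlab
      rcases Nat.lt_succ_iff_lt_or_eq.1 hi' with h1 | h1
      · exact hJ₃ i' h1 hlab
      · obtain rfl := Fin.ext h1
        exact (not_le.1 fun hle => hcond ⟨hlab, hle⟩).le
  · intro s' ⟨hf', hle, ⟨i₀, hi₀, heq⟩, hJ''⟩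
    refine ⟨hf₂.trans (hf'.mono (by simp) (by simp)), ?_, ?_⟩
    · rw [hf'.1 2 (by simp)]; exact hc₁
    · intro i hi
      rcases eq_or_ne i j with rfl | hne
      · refine le_antisymm ?_ ?_
        · obtain ⟨i₁, hi₁, hw⟩ := I.exists_worst_eq (I.label i)
          rw [← hw]
          exact hle i₁ i₁.2 (I.mem_T.1 hi₁)
        · rw [heq]
          exact worst_le (I.mem_T.2 hi₀)
      · have hne' : (i : ℕ) ≠ j := fun h => hne (Fin.ext h)
        rw [hJ'' i hne']
        exact hJ₁ i (by omega)

end RSInstance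

end RTSt

namespace RTSt

open Store

/-! ### Evaluation of one value of `π` -/

/-- The cell with the current `q`. -/
def currentQ : NExp := .get 6 (.const 0)

/-- The cell with the current `π`. -/
def currentPi : RExp := .get 8 (.const 0)

/-- The cell with the current value. -/
def currentValue : RExp := .get 9 (.const 0)

/-- Running over the tools reaches the accumulator of every tool set, because the labels are
surjective. -/
def clearStep : Program := .setReal 7 (.get 1 outer) (.const 0)

def gainStep : Program :=
  .ite (.and (.not (.natLe currentQ (.get 4 outer))) (.realLe (.get 2 outer) (.get 6 outer)))
    (.setReal 7 (.get 1 outer)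
      (.add (.get 7 (.get 1 outer)) (.sub (.get 6 outer) (.get 2 outer)))) .skip

/-- The cost of the optimal packing in the current tool set. -/
def packingCost : RExp := .sub (.get 6 outer) (.mul (.get 7 (.get 1 outer)) currentPi)

/-- A tool set is handled at its unique tool of rank zero for `C`, which carries the cost `Chat`.
Thus `ℓ` is never read and each set is counted once. -/
def chooseStep : Program :=
  .ite (.natLe (.get 5 outer) (.const 0))
    (.ite (.realLe (.get 1 outer) packingCost)
      (.seq (.setReal 9 (.const 0) (.add currentValue (.get 1 outer)))
        (.setReal 4 outer (.const 1)))
      (.seq (.setReal 9 (.const 0) (.add currentValue packingCost))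
        (.setReal 4 outer (.const 0))))
    (.setReal 4 outer (.const 0))

def startStep : Program := .setReal 9 (.const 0) (.mul (.get 0 (.const 0)) currentPi)

/-- Computes the least cost for the current `q` and `π`, and the corresponding first stage. -/
def evalProgram : Program :=
  .seq (forLoop 2 toolCount clearStep) (.seq (forLoop 2 toolCount gainStep)
    (.seq startStep (forLoop 2 toolCount chooseStep)))

/-- An upper bound on the number of steps of `evalProgram`. -/
def evalCost (n : ℕ) : ℕ :=
  forCost n clearStep.flatCost 2 + (forCost n gainStep.flatCost 2 +
    (startStep.flatCost + forCost n chooseStep.flatCost 2))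

namespace RSInstance

variable {n ℓ : ℕ} (I : RSInstance n ℓ)

/-- The memory `s` contains the input and the tables. -/
structure Tabulated (s : Store) : Prop extends I.Loaded s where
  rankNominal : ∀ j : Fin n, s.nat 4 j = I.rank I.c j
  rankFirst : ∀ j : Fin n, s.nat 5 j = I.rank I.C j
  worstCost : ∀ j : Fin n, s.real 6 j = I.worst (I.label j)

open Classical in
/-- The first-stage solution that uses the cheapest tools of the sets in `bestStage q`. -/
noncomputable def solution (q : ℕ) (j : Fin n) : ℝ :=
  if I.rank I.C j = 0 ∧ I.C j ≤ I.unitCost q (I.label j) then 1 else 0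

variable {I}

theorem Tabulated.of_frame {N R : Finset ℕ} {s s' : Store} (h : I.Tabulated s)
    (hf : Frame N R s s') (hN : ∀ a ∈ N, 2 ≤ a ∧ a ≠ 4 ∧ a ≠ 5) (hR : ∀ a ∈ R, 4 ≤ a ∧ a ≠ 6) :
    I.Tabulated s' := by
  refine ⟨h.toLoaded.of_frame hf (fun a ha => (hN a ha).1) (fun a ha => (hR a ha).1), ?_, ?_, ?_⟩
  · rw [hf.1 4 fun h => (hN 4 h).2.1 rfl]; exact h.rankNominal
  · rw [hf.1 5 fun h => (hN 5 h).2.2 rfl]; exact h.rankFirst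
  · rw [hf.2 6 fun h => (hR 6 h).2 rfl]; exact h.worstCost

theorem Chat_eq {j : Fin n} (h : I.rank I.C j = 0) : I.Chat (I.label j) = I.C j :=
  le_antisymm (Chat_le (I.mem_T.2 rfl))
    (Finset.le_inf' _ _ fun _ hi => weight_le_of_rank_eq_zero (I.mem_T.1 hi).symm h)

theorem gain_eq_sum (q : ℕ) (l : Fin ℓ) :
    I.gain q l = ∑ j, open Classical in
      if I.label j = l ∧ I.rank I.c j < q ∧ I.c j ≤ I.worst (I.label j)
        then I.worst (I.label j) - I.c j else 0 := by
  classical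
  rw [gain, cheapest, T, Finset.filter_filter, Finset.sum_filter]
  refine Finset.sum_congr rfl fun j _ => ?_
  by_cases h : I.label j = l
  · subst h; congr
  · simp [h]

/-- Each tool set has exactly one tool of rank zero. -/
theorem sum_rank_eq_zero (w : Fin n → ℝ) (f : Fin ℓ → ℝ) :
    ∑ j, (if I.rank w j = 0 then f (I.label j) else 0) = ∑ l, f l := by
  rw [sum_eq_sum_T (I := I)]
  refine Finset.sum_congr rfl fun l _ => ?_
  obtain ⟨i, hi, hr⟩ := I.exists_rank_eq_zero w l
  rw [Finset.sum_eq_single_of_mem i hi, if_pos hr, I.mem_T.1 hi]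
  intro j hj hne
  exact if_neg fun h => hne (rank_injOn w l hj hi (h.trans hr.symm))

theorem leastCost_eq_sum (q : ℕ) :
    I.leastCost q = I.Γ * (1 / q) + ∑ j, if I.rank I.C j = 0
      then min (I.C j) (I.unitCost q (I.label j)) else 0 := by
  rw [leastCost, ← I.sum_rank_eq_zero I.C]
  congr 1
  refine Finset.sum_congr rfl fun j _ => ?_
  split_ifs with h
  · rw [Chat_eq h]
  · rfl

theorem runs_evalProgram {s : Store} (h : I.Tabulated s) {q : ℕ} (hq : s.nat 6 0 = q)
    (hπ : s.real 8 0 = 1 / (q : ℝ)) :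
    Runs evalProgram s (evalCost n) fun s' => Frame {2} {4, 7, 9} s s' ∧
      s'.real 9 0 = I.leastCost q ∧ ∀ j : Fin n, s'.real 4 j = I.solution q j := by
  classical
  have hN : ∀ a ∈ ({2} : Finset ℕ), 2 ≤ a ∧ a ≠ 4 ∧ a ≠ 5 := by simp
  have hR : ∀ a ∈ ({4, 7, 9} : Finset ℕ), 4 ≤ a ∧ a ≠ 6 := by simp
  have hR' : ∀ a ∈ ({4, 9} : Finset ℕ), 4 ≤ a ∧ a ≠ 6 := by simp
  refine Runs.seq (Q := fun s' => Frame {2} {4, 7, 9} s s' ∧ ∀ l : Fin ℓ, s'.real 7 l = 0) ?_ ?_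
  · refine (Runs.forLoop (v := 2) (e := toolCount) (m := n) (N := {2}) (R := {4, 7, 9})
      (J := fun k s' => ∀ j : Fin n, (j : ℕ) < k → s'.real 7 (I.label j) = 0) (by simp)
      (fun s' hf => (h.of_frame hf hN hR).size) (fun k s' x hJ => hJ) (by simp) ?_).mono ?_
    · intro k s₁ hk hf₁ hc₁ hJ₁
      obtain ⟨j, rfl⟩ : ∃ j : Fin n, (j : ℕ) = k := ⟨⟨k, hk⟩, rfl⟩
      have ht := h.of_frame hf₁ hN hR
      refine Runs.of_loopFree trivial ?_
      simp only [clearStep, Program.run, NExp.eval, RExp.eval, outer, hc₁, ht.label]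
      refine ⟨hf₁.setReal (by simp) _ _, hc₁, fun i hi => ?_⟩
      rw [setReal_real]
      split_ifs with hcond
      · simp
      · rcases Nat.lt_succ_iff_lt_or_eq.1 hi with h1 | h1
        · exact hJ₁ i h1
        · rw [Fin.ext h1] at hcond
          simp at hcond
    · intro s' ⟨hf, hJ⟩
      refine ⟨hf, fun l => ?_⟩
      obtain ⟨j, rfl⟩ := I.label_surjective l
      exact hJ j j.2
  rintro s₁ ⟨hf₁, hz₁⟩
  refine Runs.seq (Q := fun s' => Frame {2} {4, 7, 9} s s' ∧
    ∀ l : Fin ℓ, s'.real 7 l = I.gain q l) ?_ ?_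
  · have h₁ := h.of_frame hf₁ hN hR
    have hq₁ : s₁.nat 6 0 = q := by rw [hf₁.1 6 (by simp)]; exact hq
    refine (Runs.forLoop (v := 2) (e := toolCount) (m := n) (N := {2}) (R := {4, 7, 9})
      (J := fun k s' => ∀ l : Fin ℓ, s'.real 7 l = partialSum (fun j =>
        if I.label j = l ∧ I.rank I.c j < q ∧ I.c j ≤ I.worst (I.label j)
          then I.worst (I.label j) - I.c j else 0) k) (by simp)
      (fun s' hf => (h₁.of_frame hf hN hR).size) (fun k s' x hJ => hJ)
      (fun l => by rw [hz₁, partialSum_zero]) ?_).mono ?_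
    · intro k s₂ hk hf₂ hc₂ hJ₂
      obtain ⟨j, rfl⟩ : ∃ j : Fin n, (j : ℕ) = k := ⟨⟨k, hk⟩, rfl⟩
      have ht := h₁.of_frame hf₂ hN hR
      have hq₂ : s₂.nat 6 0 = q := by rw [hf₂.1 6 (by simp)]; exact hq₁
      refine Runs.of_loopFree ⟨trivial, trivial⟩ ?_
      simp only [gainStep, Program.run, BExp.Holds, NExp.eval, RExp.eval, outer, currentQ, hc₂, hq₂,
        ht.label, ht.nominal, ht.rankNominal, ht.worstCost, not_le]
      split_ifs with hcond
      · refine ⟨hf₂.setReal (by simp) _ _, hc₂, fun l => ?_⟩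
        rw [setReal_real, partialSum_succ]
        by_cases hl : I.label j = l
        · subst hl
          simp [hcond, hJ₂]
        · have hl' : (l : ℕ) ≠ I.label j := fun h => hl (Fin.ext h.symm)
          simp [hl, hl', hJ₂]
      · refine ⟨hf₂, hc₂, fun l => ?_⟩
        rw [partialSum_succ, hJ₂, if_neg fun h => hcond h.2, add_zero]
    · intro s' ⟨hf, hJ⟩
      refine ⟨hf₁.trans hf, fun l => ?_⟩
      rw [hJ l, partialSum_all, gain_eq_sum]
  rintro s₂ ⟨hf₂, hg₂⟩
  have h₂ := h.of_frame hf₂ hN hR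
  have hπ₂ : s₂.real 8 0 = 1 / (q : ℝ) := by rw [hf₂.2 8 (by simp)]; exact hπ
  refine Runs.seq (Q := fun s' => s' = s₂.setReal 9 0 (I.Γ * (1 / q)))
    (Runs.of_loopFree trivial ?_) ?_
  · simp only [startStep, Program.run, NExp.eval, RExp.eval, currentPi, hπ₂, h₂.budget]
  rintro s₃ hs₃
  have hf₃ : Frame {2} {4, 7, 9} s s₃ := hs₃ ▸ hf₂.setReal (by simp) _ _
  have h₃ := h.of_frame hf₃ hN hR
  have hπ₃ : s₃.real 8 0 = 1 / (q : ℝ) := by rw [hf₃.2 8 (by simp)]; exact hπ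
  have hg₃ : ∀ l : Fin ℓ, s₃.real 7 l = I.gain q l := by
    intro l; rw [hs₃, setReal_real]; simpa using hg₂ l
  have hv₃ : s₃.real 9 0 = I.Γ * (1 / q) := by rw [hs₃, setReal_real]; simp
  -- Real array 7 is left out of the frame: the gains computed before must stay unchanged during
  -- this loop.
  refine (Runs.forLoop (v := 2) (e := toolCount) (m := n) (N := {2}) (R := {4, 9})
    (J := fun k s' => s'.real 9 0 = I.Γ * (1 / q) + partialSum (fun j =>
        if I.rank I.C j = 0 then min (I.C j) (I.unitCost q (I.label j)) else 0) k ∧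
      ∀ j : Fin n, (j : ℕ) < k → s'.real 4 j = I.solution q j) (by simp)
    (fun s' hf => (h₃.of_frame hf hN hR').size) (fun k s' x hJ => hJ) ?_ ?_).mono ?_
  · exact ⟨by rw [hv₃, partialSum_zero, add_zero], by simp⟩
  · intro k s₄ hk hf₄ hc₄ ⟨hJ₄, hJ₄'⟩
    obtain ⟨j, rfl⟩ : ∃ j : Fin n, (j : ℕ) = k := ⟨⟨k, hk⟩, rfl⟩
    have ht := h₃.of_frame hf₄ hN hR'
    have hπ₄ : s₄.real 8 0 = 1 / (q : ℝ) := by rw [hf₄.2 8 (by simp)]; exact hπ₃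
    have hg₄ : ∀ l : Fin ℓ, s₄.real 7 l = I.gain q l := by
      rw [hf₄.2 7 (by simp)]; exact hg₃
    have hcost : packingCost.eval s₄ = I.unitCost q (I.label j) := by
      simp only [packingCost, RExp.eval, NExp.eval, outer, currentPi, hc₄, ht.label, ht.worstCost,
        hπ₄, hg₄, unitCost]
      ring
    have hstep : ∀ (s' : Store) (a : ℝ), (∀ i : Fin n, (i : ℕ) < j → s'.real 4 i = s₄.real 4 i) →
        a = I.solution q j → ∀ i : Fin n, (i : ℕ) < j + 1 →
        (s'.setReal 4 j a).real 4 i = I.solution q i := by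
      intro s' a hs' ha i hi
      rw [setReal_real]
      rcases Nat.lt_succ_iff_lt_or_eq.1 hi with h1 | h1
      · rw [if_neg (by omega), hs' i h1]
        exact hJ₄' i h1
      · rw [Fin.ext h1]
        simpa using ha
    refine Runs.of_loopFree ⟨⟨⟨trivial, trivial⟩, trivial, trivial⟩, trivial⟩ ?_
    rw [partialSum_succ]
    simp only [chooseStep, Program.run, BExp.Holds, hcost]
    simp only [NExp.eval, RExp.eval, outer, currentValue, setReal_nat, hc₄, ht.rankFirst, ht.first,
      hJ₄, Nat.le_zero]
    split_ifs with h1 h2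
    · refine ⟨(hf₄.setReal (by simp) _ _).setReal (by simp) _ _, hc₄, ?_,
        hstep _ _ (fun i _ => by simp [setReal_real]) (by simp [solution, h1, h2])⟩
      simp [setReal_real, min_eq_left h2, add_assoc]
    · refine ⟨(hf₄.setReal (by simp) _ _).setReal (by simp) _ _, hc₄, ?_,
        hstep _ _ (fun i _ => by simp [setReal_real]) (by simp [solution, h1, h2])⟩
      simp [setReal_real, min_eq_right (not_le.1 h2).le, add_assoc, hcost]
    · refine ⟨hf₄.setReal (by simp) _ _, hc₄, ?_,
        hstep _ _ (fun i _ => rfl) (by simp [solution, h1])⟩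
      simp [setReal_real, hJ₄]
  · intro s' ⟨hf, hJ, hJ'⟩
    refine ⟨hf₃.trans (hf.mono (by simp) (by simp)), ?_, fun j => hJ' j j.2⟩
    rw [hJ, partialSum_all, leastCost_eq_sum]

end RSInstance

end RTSt

namespace RTSt

open Store

/-! ### The complete program -/

/-- The cell with the best value so far. -/
def bestValue : RExp := .get 5 (.const 0)

def initStep : Program :=
  .seq (.setReal 8 (.const 0) (.const 0)) (.setReal 10 (.const 0) (.const 0))

/-- The test `1 ≤ q` fails at `q = 0`, so the first value is always stored, whatever the best-value
cell contains. -/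
def updateStep : Program :=
  .ite (.and (.natLe (.const 1) currentQ) (.realLe bestValue currentValue)) .skip
    (.seq (.setReal 5 (.const 0) currentValue)
      (.seq (.setNat 7 (.const 0) currentQ) (.setReal 11 (.const 0) currentPi)))

/-- The machine cannot convert a natural number into a real one, so real array 10 counts along with
the loop to make the next `π` available. -/
def advanceStep : Program :=
  .seq (.setReal 10 (.const 0) (.add (.get 10 (.const 0)) (.const 1)))
    (.setReal 8 (.const 0) (.div (.const 1) (.get 10 (.const 0))))

def recallStep : Program :=
  .seq (.setNat 6 (.const 0) (.get 7 (.const 0))) (.setReal 8 (.const 0) (.get 11 (.const 0)))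

/-- Tabulates ranks and worst-case costs, evaluates `π = 0, 1, 1/2, …, 1/n`, and evaluates the best
of these values once more to recover its first-stage solution. -/
def solveProgram : Program :=
  .seq (rankProgram 2 4) (.seq (rankProgram 1 5) (.seq worstProgram (.seq initStep
    (.seq (forLoop 6 (.add toolCount (.const 1))
      (.seq evalProgram (.seq updateStep advanceStep))) (.seq recallStep evalProgram)))))

/-- An upper bound on the number of steps of `solveProgram`. -/
def solveCost (n : ℕ) : ℕ :=
  forCost n (5 + forCost n (rankStep 2 4).flatCost 2) 2 +
  (forCost n (5 + forCost n (rankStep 1 5).flatCost 2) 2 +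
  (forCost n (10 + forCost n worstStep.flatCost 2) 2 +
  (initStep.flatCost +
  (forCost (n + 1) (evalCost n + (updateStep.flatCost + advanceStep.flatCost)) 4 +
  (recallStep.flatCost + evalCost n)))))

namespace RSInstance

variable {n ℓ : ℕ} {I : RSInstance n ℓ}

theorem runs_tables {P : Program} {T : ℕ} {Q : Store → Prop} {s : Store} (h : I.Loaded s)
    (hP : ∀ s', I.Tabulated s' → Runs P s' T Q) :
    Runs (.seq (rankProgram 2 4) (.seq (rankProgram 1 5) (.seq worstProgram P))) s
      (forCost n (5 + forCost n (rankStep 2 4).flatCost 2) 2 +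
        (forCost n (5 + forCost n (rankStep 1 5).flatCost 2) 2 +
        (forCost n (10 + forCost n worstStep.flatCost 2) 2 + T))) Q := by
  refine (runs_rankProgram h (by norm_num) h.nominal).seq fun s₁ ⟨hf₁, h₁⟩ => ?_
  have hl₁ := h.of_frame hf₁ (by simp) (by simp)
  refine (runs_rankProgram hl₁ (by norm_num) hl₁.first).seq fun s₂ ⟨hf₂, h₂⟩ => ?_
  have hl₂ := hl₁.of_frame hf₂ (by simp) (by simp)
  refine (runs_worstProgram hl₂).seq fun s₃ ⟨hf₃, h₃⟩ => hP s₃ ?_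
  refine ⟨hl₂.of_frame hf₃ (by simp) (by simp), ?_, ?_, h₃⟩
  · rw [hf₃.1 4 (by simp), hf₂.1 4 (by simp)]; exact h₁
  · rw [hf₃.1 5 (by simp)]; exact h₂

/-- The state before the evaluation of `k`: the best of the values `0, …, k - 1` is stored. -/
def SearchInv (I : RSInstance n ℓ) (k : ℕ) (s : Store) : Prop :=
  s.real 10 0 = k ∧ s.real 8 0 = 1 / (k : ℝ) ∧
  (1 ≤ k → s.nat 7 0 < k ∧ s.real 11 0 = 1 / (s.nat 7 0 : ℝ) ∧
    s.real 5 0 = I.leastCost (s.nat 7 0) ∧ ∀ p < k, I.leastCost (s.nat 7 0) ≤ I.leastCost p)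

theorem searchInv_step {k : ℕ} {s s₁ : Store} (h : I.SearchInv k s) (hk : s.nat 6 0 = k)
    (hf : Frame {2} {4, 7, 9} s s₁) (hv : s₁.real 9 0 = I.leastCost k) :
    Runs (.seq updateStep advanceStep) s₁ (updateStep.flatCost + advanceStep.flatCost)
      fun s' => Frame {2, 6, 7} {4, 5, 7, 8, 9, 10, 11} s s' ∧ s'.nat 6 0 = k ∧
        I.SearchInv (k + 1) s' := by
  obtain ⟨h10, h8, hbest⟩ := h
  have hk₁ : s₁.nat 6 0 = k := by rw [hf.1 6 (by simp)]; exact hk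
  have hf₁ : Frame {2, 6, 7} {4, 5, 7, 8, 9, 10, 11} s s₁ :=
    hf.mono (by simp) (by intro a; simp; omega)
  rw [← hf.2 10 (by simp)] at h10
  rw [← hf.2 8 (by simp)] at h8
  rw [← hf.2 5 (by simp), ← hf.2 11 (by simp), ← hf.1 7 (by simp)] at hbest
  refine Runs.seq (Q := fun s' => Frame {2, 6, 7} {4, 5, 7, 8, 9, 10, 11} s s' ∧ s'.nat 6 0 = k ∧
    s'.real 10 0 = k ∧ s'.nat 7 0 < k + 1 ∧ s'.real 11 0 = 1 / (s'.nat 7 0 : ℝ) ∧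
    s'.real 5 0 = I.leastCost (s'.nat 7 0) ∧ ∀ p < k + 1, I.leastCost (s'.nat 7 0) ≤ I.leastCost p)
    (Runs.of_loopFree ⟨trivial, trivial, trivial, trivial⟩ ?_) ?_
  · simp only [updateStep, Program.run, BExp.Holds, NExp.eval, RExp.eval, bestValue, currentValue,
      currentQ, currentPi, setReal_nat, setReal_real, setNat_real, hk₁, hv, h8, Nat.reduceEqDiff,
      false_and, if_false]
    split_ifs with hcond
    · obtain ⟨b1, b2, b3, b4⟩ := hbest hcond.1
      refine ⟨hf₁, hk₁, h10, by omega, b2, b3, fun p hp => ?_⟩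
      rcases Nat.lt_succ_iff_lt_or_eq.1 hp with h1 | rfl
      · exact b4 p h1
      · rw [← b3]; exact hcond.2
    · refine ⟨((hf₁.setReal (by simp) _ _).setNat (by simp) _ _).setReal (by simp) _ _, ?_⟩
      simp only [setReal_nat, setReal_real, setNat_real, setNat_nat, hk₁, h10]
      simp only [Nat.reduceEqDiff, false_and, if_false, and_self, if_true, true_and,
        Nat.lt_succ_self]
      intro p hp
      rcases Nat.lt_succ_iff_lt_or_eq.1 hp with h1 | rfl
      · obtain ⟨b1, b2, b3, b4⟩ := hbest (by omega)
        have : ¬ s₁.real 5 0 ≤ I.leastCost k := fun hle => hcond ⟨by omega, hle⟩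
        rw [b3] at this
        exact (not_le.1 this).le.trans (b4 p h1)
      · exact le_rfl
  · rintro s₂ ⟨hf₂, hk₂, h10₂, b1, b2, b3, b4⟩
    refine Runs.of_loopFree ⟨trivial, trivial⟩ ?_
    refine ⟨(hf₂.setReal (by simp) _ _).setReal (by simp) _ _, hk₂, ?_, ?_, fun _ => ⟨b1, ?_⟩⟩
    all_goals simp [advanceStep, Program.run, NExp.eval, RExp.eval, setReal_real, setReal_nat, h10₂]
    exact ⟨by simpa using b2, b3, fun p hp => b4 p (Nat.lt_succ_of_le hp)⟩

theorem runs_search {s : Store} (h : I.Tabulated s) (h0 : I.SearchInv 0 s) :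
    Runs (forLoop 6 (.add toolCount (.const 1)) (.seq evalProgram (.seq updateStep advanceStep))) s
      (forCost (n + 1) (evalCost n + (updateStep.flatCost + advanceStep.flatCost)) 4)
      fun s' => I.Tabulated s' ∧ I.SearchInv (n + 1) s' := by
  have hN : ∀ a ∈ ({2, 6, 7} : Finset ℕ), 2 ≤ a ∧ a ≠ 4 ∧ a ≠ 5 := by simp
  have hR : ∀ a ∈ ({4, 5, 7, 8, 9, 10, 11} : Finset ℕ), 4 ≤ a ∧ a ≠ 6 := by simp
  refine (Runs.forLoop (v := 6) (e := .add toolCount (.const 1)) (m := n + 1) (N := {2, 6, 7})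
    (R := {4, 5, 7, 8, 9, 10, 11}) (J := I.SearchInv) (by simp) ?_ ?_ h0 ?_).mono
    fun s' hs' => ⟨h.of_frame hs'.1 hN hR, hs'.2⟩
  · intro s' hf
    simp [NExp.eval, toolCount, (h.of_frame hf hN hR).size]
  · intro k s' x hJ
    simpa [SearchInv, setNat_nat, setNat_real] using hJ
  · intro k s₁ _ hf₁ hc₁ hJ₁
    refine (runs_evalProgram (h.of_frame hf₁ hN hR) hc₁ hJ₁.2.1).seq fun s₂ ⟨hf₂, hv₂, _⟩ => ?_
    exact (searchInv_step hJ₁ hc₁ hf₂ hv₂).mono fun s' hs' => ⟨hf₁.trans hs'.1, hs'.2⟩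

theorem runs_solveProgram (I : RSInstance n ℓ) :
    Runs solveProgram I.encode (solveCost n) fun s => ∃ q ≤ n,
      (∀ p ≤ n, I.leastCost q ≤ I.leastCost p) ∧ s.real 5 0 = I.leastCost q ∧
      ∀ j : Fin n, s.real 4 j = I.solution q j := by
  refine runs_tables I.loaded_encode fun s₁ h₁ => ?_
  refine Runs.seq (Q := fun s' => I.Tabulated s' ∧ I.SearchInv 0 s')
    (Runs.of_loopFree ⟨trivial, trivial⟩ ⟨?_, ?_⟩) fun s₂ h₂ => ?_
  · exact h₁.of_frame (((Frame.refl ∅ {8, 10} s₁).setReal (by simp) _ _).setReal (by simp) _ _)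
      (by simp) (by simp)
  · simp [initStep, Program.run, NExp.eval, RExp.eval, SearchInv, setReal_real]
  refine (runs_search h₂.1 h₂.2).seq fun s₃ ⟨h₃, _, _, hbest⟩ => ?_
  obtain ⟨b1, b2, b3, b4⟩ := hbest (by omega)
  refine Runs.seq (Q := fun s' => Frame {6} {8} s₃ s' ∧ s'.nat 6 0 = s₃.nat 7 0 ∧
    s'.real 8 0 = 1 / (s₃.nat 7 0 : ℝ)) (Runs.of_loopFree ⟨trivial, trivial⟩ ?_)
    fun s₄ ⟨hf₄, hq₄, hπ₄⟩ => ?_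
  · refine ⟨((Frame.refl {6} {8} s₃).setNat (by simp) _ _).setReal (by simp) _ _, ?_, ?_⟩
    · simp [recallStep, Program.run, NExp.eval, setReal_nat, setNat_nat]
    · simpa [recallStep, Program.run, NExp.eval, RExp.eval, setReal_real, setNat_real] using b2
  refine (runs_evalProgram (h₃.of_frame hf₄ (by simp) (by simp)) hq₄ hπ₄).mono
    fun s' ⟨hf, _, hx⟩ => ⟨s₃.nat 7 0, by omega, fun p hp => b4 p (by omega), ?_, hx⟩
  -- The repeated evaluation rewrites the first stage in real array 4 but leaves the optimal value
  -- in real array 5.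
  rw [hf.2 5 (by simp), hf₄.2 5 (by simp)]
  exact b3

/-- The tools of rank zero for `C` are cheapest representatives, so `solution q` is `bestStage q`
placed on them. -/
theorem solvedBy_of_leastCost {q : ℕ} (hq : ∀ p ≤ n, I.leastCost q ≤ I.leastCost p) {s : Store}
    (hv : s.real 5 0 = I.leastCost q) (hx : ∀ j : Fin n, s.real 4 j = I.solution q j) :
    I.SolvedBy s := by
  choose rep hrep hrank using fun l => I.exists_rank_eq_zero I.C l
  have hC : ∀ l, I.C (rep l) = I.Chat l := by
    intro l
    rw [← Chat_eq (hrank l), I.mem_T.1 (hrep l)]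
  have hsol : (fun j : Fin n => s.real 4 j)
      = fun j => if j = rep (I.label j) then I.bestStage q (I.label j) else 0 := by
    funext j
    rw [hx j, solution]
    have hiff : I.rank I.C j = 0 ↔ j = rep (I.label j) :=
      ⟨fun h => rank_injOn I.C (I.label j) (I.mem_T.2 rfl) (hrep _) (h.trans (hrank _).symm),
        fun h => by rw [h]; exact hrank _⟩
    by_cases h : j = rep (I.label j)
    · have h0 := hiff.2 h
      rw [if_pos h, bestStage, Chat_eq h0]
      simp [h0]
    · rw [if_neg h, if_neg fun h' => h (hiff.1 h'.1)]
  have hmin := totalCost_bestStage_le hq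
  have hz := I.binary_bestStage q
  rw [← totalCost_bestStage] at hv
  rw [SolvedBy, hsol, hv]
  exact ⟨select_mem_partialSolutions hrep hz, isEval_select hz hmin hrep hC,
    isOptimalValue_totalCost hz hmin⟩

end RSInstance

/-! ### Running time -/

/-- `f` grows at most like the `d`-th power. -/
def PolyBound (d : ℕ) (f : ℕ → ℕ) : Prop := ∃ K, ∀ n, f n ≤ K * (n + 1) ^ d

section PolyBound

variable {d : ℕ} {f g : ℕ → ℕ}

theorem PolyBound.const (d k : ℕ) : PolyBound d fun _ => k :=
  ⟨k, fun n => Nat.le_mul_of_pos_right k (by positivity)⟩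

theorem PolyBound.add (hf : PolyBound d f) (hg : PolyBound d g) :
    PolyBound d fun n => f n + g n := by
  obtain ⟨K, hK⟩ := hf
  obtain ⟨L, hL⟩ := hg
  exact ⟨K + L, fun n => (Nat.add_le_add (hK n) (hL n)).trans_eq (by ring)⟩

theorem PolyBound.succ (hf : PolyBound d f) : PolyBound (d + 1) f := by
  obtain ⟨K, hK⟩ := hf
  exact ⟨K, fun n => (hK n).trans
    (Nat.mul_le_mul_left K (Nat.pow_le_pow_right (Nat.succ_pos n) (Nat.le_succ d)))⟩

/-- Each loop raises the degree by one. Up to `n + 1` rounds are allowed because the search also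
visits `q = 0`. -/
theorem PolyBound.forCost (hf : PolyBound d f) {m : ℕ → ℕ} (hm : ∀ n, m n ≤ n + 1) (c : ℕ) :
    PolyBound (d + 1) fun n => forCost (m n) (f n) c := by
  obtain ⟨K, hK⟩ := hf.add (PolyBound.const d (c + 11))
  refine ⟨K + (c + 8), fun n => ?_⟩
  have h1 : m n * (f n + c + 11) ≤ (n + 1) * (K * (n + 1) ^ d) :=
    Nat.mul_le_mul (hm n) (hK n)
  have h2 : c + 8 ≤ (c + 8) * (n + 1) ^ (d + 1) := Nat.le_mul_of_pos_right _ (by positivity)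
  calc RTSt.forCost (m n) (f n) c = m n * (f n + c + 11) + (c + 8) := rfl
    _ ≤ (n + 1) * (K * (n + 1) ^ d) + (c + 8) * (n + 1) ^ (d + 1) := Nat.add_le_add h1 h2
    _ = (K + (c + 8)) * (n + 1) ^ (d + 1) := by ring

end PolyBound

theorem polyBound_solveCost : PolyBound 2 solveCost := by
  have hm : ∀ n : ℕ, n ≤ n + 1 := Nat.le_succ
  have hc := PolyBound.const
  have htab : ∀ a b : ℕ, PolyBound 2 fun n => forCost n (a + forCost n b 2) 2 := fun a b =>
    ((hc 1 a).add ((hc 0 b).forCost hm 2)).forCost hm 2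
  have heval : PolyBound 1 evalCost :=
    ((hc 0 _).forCost hm 2).add (((hc 0 _).forCost hm 2).add
      ((hc 1 _).add ((hc 0 _).forCost hm 2)))
  exact (htab _ _).add ((htab _ _).add ((htab _ _).add ((hc 2 _).add
    (((heval.add (hc 1 _)).forCost (fun _ => le_rfl) 4).add ((hc 2 _).add heval.succ)))))

theorem isBigO_of_polyBound {f : ℕ → ℕ} (h : PolyBound 2 f) :
    Asymptotics.IsBigO Filter.atTop (fun n : ℕ => (f n : ℝ))
      (fun n : ℕ => (n : ℝ) ^ 2 * Real.log n) := by
  obtain ⟨K, hK⟩ := h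
  refine Asymptotics.IsBigO.of_bound (4 * K) ?_
  -- From 3 on, `Real.log n ≥ 1` since `e < 3`, so the quadratic bound is absorbed.
  filter_upwards [Filter.eventually_ge_atTop 3] with n hn
  have hn3 : (3 : ℝ) ≤ n := by exact_mod_cast hn
  have hlog : 1 ≤ Real.log n := by
    rw [Real.le_log_iff_exp_le (by linarith)]
    exact Real.exp_one_lt_three.le.trans hn3
  have h1 : (f n : ℝ) ≤ K * ((n : ℝ) + 1) ^ 2 := by exact_mod_cast hK n
  have h2 : ((n : ℝ) + 1) ^ 2 ≤ 4 * ((n : ℝ) ^ 2 * Real.log n) := by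
    have : (n : ℝ) ^ 2 ≤ (n : ℝ) ^ 2 * Real.log n := le_mul_of_one_le_right (by positivity) hlog
    nlinarith
  rw [Real.norm_of_nonneg (by positivity), Real.norm_of_nonneg (by positivity)]
  calc (f n : ℝ) ≤ K * ((n : ℝ) + 1) ^ 2 := h1
    _ ≤ K * (4 * ((n : ℝ) ^ 2 * Real.log n)) := mul_le_mul_of_nonneg_left h2 (Nat.cast_nonneg K)
    _ = 4 * K * ((n : ℝ) ^ 2 * Real.log n) := by ring

end RTSt

theorem mainTheorem4 :
    -- one program solves all instances exactly, in O(n² log n) steps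
    (∃ (P : RTSt.Program) (time : ℕ → ℕ),
      Asymptotics.IsBigO Filter.atTop (fun n : ℕ => (time n : ℝ))
        (fun n : ℕ => (n : ℝ) ^ 2 * Real.log n) ∧
      ∀ (n ℓ : ℕ) (I : RTSt.RSInstance n ℓ),
        ∃ (s : RTSt.Store) (t : ℕ),
          RTSt.Exec P I.encode s t ∧ t ≤ time n ∧ I.SolvedBy s) ∧
    -- the mixed-integer program has the same optimal value, and it has an optimal solution with
    -- `π = 0` or `π = 1 / p` that is a vertex of the linear program for its `x`
    (∀ (n ℓ : ℕ) (I : RTSt.RSInstance n ℓ),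
      ∃ (x : Fin ℓ → ℝ) (u v : Fin n → ℝ) (π : ℝ),
        I.MIPFeasible x u v π ∧
        (∀ x' u' v' π', I.MIPFeasible x' u' v' π' → I.obj x u v π ≤ I.obj x' u' v' π') ∧
        RTSt.IsOptimalValue I.X I.U I.C (I.obj x u v π) ∧
        (u, v, π) ∈ (I.polytope x).extremePoints ℝ ∧
        (π = 0 ∨ ∃ p : ℕ, 1 ≤ p ∧ p ≤ n ∧ π = 1 / (p : ℝ))) ∧
    -- for each fixed `π` there is a greedy packing, and every greedy packing gives an optimal
    -- solution
    (∀ (n ℓ : ℕ) (I : RTSt.RSInstance n ℓ) (π : ℝ), 0 ≤ π → π ≤ 1 →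
      (∃ u v : Fin n → ℝ, I.IsGreedyPacking π u v) ∧
      ∀ u v : Fin n → ℝ, I.IsGreedyPacking π u v →
        I.MIPFeasible (I.firstStage u v) (I.keep u v u) (I.keep u v v) π ∧
        ∀ x' u' v', I.MIPFeasible x' u' v' π →
          I.obj (I.firstStage u v) (I.keep u v u) (I.keep u v v) π ≤ I.obj x' u' v' π) := by
  refine ⟨⟨RTSt.solveProgram, RTSt.solveCost, RTSt.isBigO_of_polyBound RTSt.polyBound_solveCost,
    fun n ℓ I => ?_⟩, fun n ℓ I => I.exists_optimal_vertex, fun n ℓ I π h0 h1 =>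
    ⟨I.exists_isGreedyPacking h0 h1, fun u v h => RTSt.RSInstance.firstStage_optimal h0 h1 h⟩⟩
  obtain ⟨s, t, hexec, ht, q, _, hmin, hv, hx⟩ := I.runs_solveProgram
  exact ⟨s, t, hexec, ht, RTSt.RSInstance.solvedBy_of_leastCost hmin hv hx⟩
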